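/- Let $R$ be the hyperfinite $\mathrm{II}_1$ factor with its faithful normal tracial state $\tau$, let $\theta\in(0,1)$ be irrational, and let $u,v\in R$ be unitary operators with $R=\{u,v\}''$ and $vu=e^{2\pi i\theta}uv$. For $T\in R$ let $\Delta(T)=\exp\bigl(\tau(\ln|T|)\bigr)\in[0,\infty)$ denote the Fuglede--Kadison determinant, where $\tau(\ln|T|)=\int\ln t\,d\mu_{|T|}(t)\in[-\infty,\infty)$, $\mu_{|T|}$ is the spectral distribution of $|T|=(T^*T)^{1/2}$ with respect to $\tau$, and $\ln 0:=-\infty$, $\exp(-\infty):=0$. Let $f$ be a continuous complex-valued function on the unit circle $S^1$, and let $f(v)$ be given by the continuous functional calculus. Then $$\Delta(f(v))=\exp\int_0^1\ln|f(e^{2\pi ix})|\,dx$$ (with the same conventions), and the spectrum of $uf(v)$ is as follows: \begin{enumerate} \item if $f(v)$ is invertible, then $\sigma(uf(v))=\Delta(f(v))S^1=\{\lambda\in\mathbb C:|\lambda|=\Delta(f(v))\}$; \item if $f(v)$ is not invertible, then $\sigma(uf(v))=\{\lambda\in\mathbb C:|\lambda|\le\Delta(f(v))\}$. \end{enumerate}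 -/

import Mathlib

open scoped ENNReal CompactlySupported

noncomputable section

/-- A von Neumann algebra, regarded as an algebra in its own right, is a C*-algebra
(with the operator norm of the ambient `H →L[ℂ] H`). -/
instance VonNeumannAlgebra.instCStarAlgebraCarrier {H : Type*} [NormedAddCommGroup H]
    [InnerProductSpace ℂ H] [CompleteSpace H] (R : VonNeumannAlgebra H) :
    CStarAlgebra R.toStarSubalgebra :=
  StarSubalgebra.cstarAlgebra R.toStarSubalgebra (h_closed := by
    have h := Set.isClosed_centralizer (Set.centralizer (R : Set (H →L[ℂ] H)))
    rw [R.centralizer_centralizer] at h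
    exact h)

/-- A tracial state on a unital C*-algebra. -/
structure TracialState (A : Type*) [CStarAlgebra A] extends A →ₗ[ℂ] ℂ where
  map_one' : toFun 1 = 1
  nonneg_re' : ∀ a : A, 0 ≤ (toFun (star a * a)).re
  im_eq_zero' : ∀ a : A, (toFun (star a * a)).im = 0
  tracial' : ∀ a b : A, toFun (a * b) = toFun (b * a)

namespace TracialState

variable {A : Type*} [CStarAlgebra A]

/-- `τ` is faithful: `τ(a*a) = 0` only if `a = 0`. -/
def IsFaithful (τ : TracialState A) : Prop :=
  ∀ a : A, τ.toLinearMap (star a * a) = 0 → a = 0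

/-- The real linear functional `g ↦ τ(g(a))`, which is positive on `C_c(ℝ, ℝ)`
(`g(a)` is the continuous functional calculus of the self-adjoint element `a`). -/
def cfcFunctional (τ : TracialState A) (a : A) : C_c(ℝ, ℝ) →ₚ[ℝ] ℝ :=
  PositiveLinearMap.mk₀
    { toFun := fun g => (τ.toLinearMap (cfc (fun t : ℝ => g t) a)).re
      map_add' := fun g h => by
        have : cfc (fun t : ℝ => (g + h) t) a = cfc (fun t : ℝ => g t) a + cfc (fun t : ℝ => h t) a :=
          cfc_add a (fun t : ℝ => g t) (fun t : ℝ => h t)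
            g.continuous.continuousOn h.continuous.continuousOn
        rw [this, map_add, Complex.add_re]
      map_smul' := fun c g => by
        have : cfc (fun t : ℝ => (c • g) t) a = c • cfc (fun t : ℝ => g t) a :=
          cfc_smul c (fun t : ℝ => g t) a g.continuous.continuousOn
        rw [this, ← Complex.coe_smul, map_smul]
        simp }
    (fun g hg => by
      have hs : Continuous (fun t : ℝ => Real.sqrt (g t)) := by fun_prop
      have h0 : IsSelfAdjoint (cfc (fun t : ℝ => Real.sqrt (g t)) a) := cfc_predicate _ a
      have h1 : cfc (fun t : ℝ => g t) a
          = star (cfc (fun t : ℝ => Real.sqrt (g t)) a) * cfc (fun t : ℝ => Real.sqrt (g t)) a := by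
        rw [h0.star_eq, ← cfc_mul _ _ a hs.continuousOn hs.continuousOn]
        exact cfc_congr fun t _ => (Real.mul_self_sqrt (hg t)).symm
      show 0 ≤ (τ.toLinearMap (cfc (fun t : ℝ => g t) a)).re
      rw [h1]
      exact τ.nonneg_re' _)

/-- The spectral distribution `μ_a` of a self-adjoint element `a` with respect to `τ`: the
regular Borel measure on `ℝ` with `∫ g dμ_a = τ(g(a))`, i.e. `τ` composed with the
spectral projections of `a`. -/
def spectralDistribution (τ : TracialState A) (a : A) : MeasureTheory.Measure ℝ :=
  RealRMK.rieszMeasure (τ.cfcFunctional a)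

end TracialState

/-- The integral, with values in `[-∞, ∞]`, of an extended-real function: the integral of the
positive part minus the integral of the negative part. -/
def extIntegral {X : Type*} [MeasurableSpace X] (μ : MeasureTheory.Measure X) (h : X → EReal) :
    EReal :=
  ((∫⁻ x, (h x).toENNReal ∂μ : ℝ≥0∞) : EReal) - ((∫⁻ x, (-h x).toENNReal ∂μ : ℝ≥0∞) : EReal)

/-- The absolute value `|T| = (T*T)^{1/2}`. -/
def absValue {A : Type*} [CStarAlgebra A] (T : A) : A :=
  cfc Real.sqrt (star T * T)

/-- The Fuglede--Kadison determinant `Δ(T) = exp (τ(ln |T|))`, where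
`τ(ln |T|) = ∫ ln t dμ_{|T|}(t) ∈ [-∞, ∞)`, `ln 0 = -∞` and `exp (-∞) = 0`. -/
def fugledeKadisonDet {A : Type*} [CStarAlgebra A] (τ : TracialState A) (T : A) : ℝ :=
  (EReal.exp (extIntegral (τ.spectralDistribution (absValue T))
    (fun t : ℝ => ENNReal.log (ENNReal.ofReal t)))).toReal

/-- `exp ∫₀¹ ln |f(e^{2πix})| dx`, where the integral is in `[-∞, ∞)`, `ln 0 = -∞` and
`exp (-∞) = 0`. -/
def expIntegralLog (f : ℂ → ℂ) : ℝ :=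
  (EReal.exp (extIntegral (MeasureTheory.volume.restrict (Set.Icc (0 : ℝ) 1))
    (fun x : ℝ => ENNReal.log (‖f (Complex.exp (2 * Real.pi * Complex.I * x))‖ₑ)))).toReal

section VonNeumann

variable {H : Type*} [NormedAddCommGroup H] [InnerProductSpace ℂ H] [CompleteSpace H]

/-- `τ` is normal: it preserves suprema of (bounded) increasing nets of self-adjoint elements. -/
def TracialState.IsNormal {R : VonNeumannAlgebra H} (τ : TracialState R.toStarSubalgebra) : Prop :=
  ∀ (D : Set R.toStarSubalgebra) (s : R.toStarSubalgebra), D.Nonempty →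
    (∀ x ∈ D, IsSelfAdjoint x) →
    DirectedOn (fun x y : R.toStarSubalgebra => (x : H →L[ℂ] H) ≤ (y : H →L[ℂ] H)) D →
    IsLUB ((fun x : R.toStarSubalgebra => (x : H →L[ℂ] H)) '' D) (s : H →L[ℂ] H) →
    IsLUB ((fun x => (τ.toLinearMap x).re) '' D) (τ.toLinearMap s).re

/-- `R` is a hyperfinite II₁ factor: an infinite-dimensional factor with a faithful normal tracial
state which is generated, as a von Neumann algebra, by an increasing sequence of
finite-dimensional `*`-subalgebras. -/
structure IsHyperfiniteIIOneFactor (R : VonNeumannAlgebra H) : Prop where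
  factor : ∀ x ∈ R, x ∈ R.commutant → ∃ c : ℂ, x = c • (1 : H →L[ℂ] H)
  infinite_dimensional : ¬ FiniteDimensional ℂ R.toStarSubalgebra
  exists_trace : ∃ τ : TracialState R.toStarSubalgebra, τ.IsFaithful ∧ τ.IsNormal
  hyperfinite : ∃ F : ℕ → StarSubalgebra ℂ (H →L[ℂ] H), Monotone F ∧
    (∀ n, FiniteDimensional ℂ (F n)) ∧
    Set.centralizer (Set.centralizer (⋃ n, (F n : Set (H →L[ℂ] H)))) = (R : Set (H →L[ℂ] H))

end VonNeumann

end

/-!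
Write `w = exp (2πiθ)` and `T = u f(v)`. Since `u* v u = w v`, conjugation by `u` rotates the
functional calculus of `v`, so `σ(v)` is the whole circle, `τ(g(v))` is the Haar integral of `g`
(`trace_cfc`), and the spectral distribution of `|f(v)|` is the image of Haar measure under `|f|`.
This gives `Δ(f(v)) = D` with `D = exp ∫ log |f|` (`fugledeKadisonDet_cfc`).

The powers `T ^ m = u ^ m f_m(v)` are weighted by the cocycle `f_m(z) = ∏ k < m, f (w ^ k z)`
(`mul_cfc_pow`), whose growth is governed by uniform equidistribution of the orbits of the
rotation: `sup |f_m|` falls below `r ^ m` for some `m` if `r > D` (`exists_norm_prod_lt_pow`), is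
never below `D ^ m` (`pow_le_of_norm_prod_le`), and `inf |f_m|` exceeds `r ^ m` for some `m` if
`0 < r < D` and `f` has no zeros (`exists_pow_lt_norm_prod`). Hence `σ(T)` lies in the closed disc
of radius `D`, and in its boundary circle if `f(v)` is invertible. As `v T v* = w T`, the closed
set `σ(T)` is a union of circles about `0`, which settles the invertible case.

If `f(z₀) = 0`, the claim is that no `c` with `0 < |c| < D` has a resolvent `R = (c - T)⁻¹`
(`expIntegralLog_le_norm_of_notMem_spectrum`). The Fourier coefficients `R_m = E(u⁻ᵐ R)`, where `E`
is the conditional expectation onto the algebra of `v`, satisfy `c R_m(z) = f(w^(m-1) z) R_{m-1}(z)`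
for `m ≠ 0` and `c R_0(z) = 1 + f(w⁻¹ z) R_{-1}(z)`, and `|R_m| ≤ ‖R‖`. So `c R_0` is close to `1`
near `w z₀`, and therefore `|f_m| ≤ C |c| ^ m` there. The orbits reach that neighbourhood in
bounded time, which spreads this bound to the whole circle and contradicts `sup |f_m| ≥ D ^ m`. The
expectation `E` is not needed as an object: the argument is carried out with `τ` tested against
functions of `v` (`traceNorm_le_of_resolvent`), with Cauchy--Schwarz in place of the bound on `R_m`.
-/

open scoped ENNReal

namespace RotationAlgebra

open MeasureTheory Filter Topology

/-! ### Functions on the unit circle -/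

lemma norm_toCircle (x : UnitAddCircle) : ‖(x.toCircle : ℂ)‖ = 1 :=
  Circle.norm_coe _

lemma toCircle_mem_sphere (x : UnitAddCircle) : (x.toCircle : ℂ) ∈ Metric.sphere (0 : ℂ) 1 := by
  simpa using norm_toCircle x

lemma exists_toCircle_eq {z : ℂ} (hz : z ∈ Metric.sphere (0 : ℂ) 1) :
    ∃ x : UnitAddCircle, (x.toCircle : ℂ) = z := by
  obtain ⟨x, hx⟩ := (AddCircle.homeomorphCircle (one_ne_zero : (1 : ℝ) ≠ 0)).surjective
    ⟨z, by simpa [Submonoid.unitSphere] using hz⟩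
  refine ⟨x, ?_⟩
  rw [AddCircle.homeomorphCircle_apply] at hx
  rw [hx]

lemma continuous_comp_toCircle {E : Type*} [TopologicalSpace E] {f : ℂ → E}
    (hf : ContinuousOn f (Metric.sphere (0 : ℂ) 1)) :
    Continuous fun x : UnitAddCircle => f (x.toCircle : ℂ) :=
  hf.comp_continuous (continuous_subtype_val.comp AddCircle.continuous_toCircle)
    toCircle_mem_sphere

lemma integrable_comp_toCircle {E : Type*} [NormedAddCommGroup E] {f : ℂ → E}
    (hf : ContinuousOn f (Metric.sphere (0 : ℂ) 1)) :
    Integrable fun x : UnitAddCircle => f (x.toCircle : ℂ) :=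
  (continuous_comp_toCircle hf).integrable_of_hasCompactSupport
    (HasCompactSupport.of_compactSpace _)

lemma continuousOn_zpow_sphere (n : ℤ) :
    ContinuousOn (fun z : ℂ => z ^ n) (Metric.sphere (0 : ℂ) 1) :=
  continuousOn_id.zpow₀ n fun z hz => Or.inl (by rintro rfl; simp at hz)

/-- A property of continuous functions on the circle that holds for the characters `z ↦ z ^ n`
and is stable under linear combinations and uniform limits holds for all of them: trigonometric
polynomials are dense. -/
lemma sphere_induction {P : (ℂ → ℂ) → Prop}
    (zpow : ∀ n : ℤ, P fun z => z ^ n)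
    (add : ∀ f g, ContinuousOn f (Metric.sphere (0 : ℂ) 1) →
      ContinuousOn g (Metric.sphere (0 : ℂ) 1) → P f → P g → P fun z => f z + g z)
    (smul : ∀ (c : ℂ) f, ContinuousOn f (Metric.sphere (0 : ℂ) 1) → P f → P fun z => c * f z)
    (lim : ∀ f, ContinuousOn f (Metric.sphere (0 : ℂ) 1) →
      (∀ ε > 0, ∃ p, ContinuousOn p (Metric.sphere (0 : ℂ) 1) ∧ P p ∧
        ∀ z ∈ Metric.sphere (0 : ℂ) 1, ‖f z - p z‖ ≤ ε) → P f)
    {f : ℂ → ℂ} (hf : ContinuousOn f (Metric.sphere (0 : ℂ) 1)) : P f := by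
  refine lim f hf fun ε hε => ?_
  have key : ∀ q ∈ Submodule.span ℂ (Set.range (@fourier 1)),
      ∃ p : ℂ → ℂ, ContinuousOn p (Metric.sphere (0 : ℂ) 1) ∧ P p ∧
        ∀ x : UnitAddCircle, p (x.toCircle : ℂ) = q x := by
    intro q hq
    induction hq using Submodule.span_induction with
    | mem q hq =>
      obtain ⟨n, rfl⟩ := hq
      refine ⟨_, continuousOn_zpow_sphere n, zpow n, fun x => ?_⟩
      rw [fourier_apply, AddCircle.toCircle_zsmul]
      simp
    | zero =>
      exact ⟨_, continuousOn_const.mul (continuousOn_zpow_sphere 0),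
        smul 0 _ (continuousOn_zpow_sphere 0) (zpow 0), fun x => by simp⟩
    | add q r _ _ hq hr =>
      obtain ⟨p, hp, hP, hpq⟩ := hq
      obtain ⟨s, hs, hS, hsr⟩ := hr
      exact ⟨_, hp.add hs, add p s hp hs hP hS, fun x => by simp [hpq, hsr]⟩
    | smul c q _ hq =>
      obtain ⟨p, hp, hP, hpq⟩ := hq
      exact ⟨_, continuousOn_const.mul hp, smul c p hp hP, fun x => by simp [hpq]⟩
  let F : C(UnitAddCircle, ℂ) := ⟨fun x => f x.toCircle, continuous_comp_toCircle hf⟩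
  have hF : F ∈ (Submodule.span ℂ (Set.range (@fourier 1))).topologicalClosure := by
    rw [span_fourier_closure_eq_top]; trivial
  obtain ⟨q, hq, hFq⟩ := Metric.mem_closure_iff.1 hF ε hε
  obtain ⟨p, hp, hP, hpq⟩ := key q hq
  refine ⟨p, hp, hP, fun z hz => ?_⟩
  obtain ⟨x, rfl⟩ := exists_toCircle_eq hz
  rw [hpq x, ← dist_eq_norm]
  exact (ContinuousMap.dist_apply_le_dist (f := F) x).trans hFq.le

lemma integral_zpow_toCircle {n : ℤ} (hn : n ≠ 0) :
    ∫ x : UnitAddCircle, (x.toCircle : ℂ) ^ n = 0 := by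
  have h := integral_eq_zero_of_add_right_eq_neg (μ := (volume : Measure UnitAddCircle))
      (fourier_add_half_inv_index hn one_pos)
  simpa [fourier_apply, AddCircle.toCircle_zsmul] using h

/-! ### Equidistribution of the orbits of an irrational rotation -/

/-- Weyl's equidistribution theorem, with the uniformity in the starting point. -/
lemma weyl_equidistribution {w : ℂ} (hw : ‖w‖ = 1) (hw' : ∀ n : ℤ, n ≠ 0 → w ^ n ≠ 1)
    {f : ℂ → ℂ} (hf : ContinuousOn f (Metric.sphere (0 : ℂ) 1)) :
    ∀ ε > 0, ∃ N₀ : ℕ, ∀ N ≥ N₀, ∀ z ∈ Metric.sphere (0 : ℂ) 1,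
      ‖∑ k ∈ Finset.range N, f (w ^ k * z) - N * ∫ x : UnitAddCircle, f x.toCircle‖ ≤ ε * N := by
  have hmem : ∀ (k : ℕ), ∀ z ∈ Metric.sphere (0 : ℂ) 1, w ^ k * z ∈ Metric.sphere (0 : ℂ) 1 := by
    intro k z hz
    simpa [hw] using hz
  refine sphere_induction (P := fun f => ∀ ε > 0, ∃ N₀ : ℕ, ∀ N ≥ N₀, ∀ z ∈ Metric.sphere (0 : ℂ) 1,
      ‖∑ k ∈ Finset.range N, f (w ^ k * z) - N * ∫ x : UnitAddCircle, f x.toCircle‖ ≤ ε * N)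
      ?_ ?_ ?_ ?_ hf
  · intro n ε hε
    rcases eq_or_ne n 0 with rfl | hn
    · refine ⟨0, fun N _ z hz => ?_⟩
      have : 0 ≤ ε * N := by positivity
      simpa [measureReal_def] using this
    · have h1 := hw' n hn
      have h2 : 0 < ‖w ^ n - 1‖ := norm_pos_iff.2 (sub_ne_zero.2 h1)
      obtain ⟨N₀, hN₀⟩ := exists_nat_gt (2 / ‖w ^ n - 1‖ / ε)
      refine ⟨N₀, fun N hN z hz => ?_⟩
      have hz1 : ‖z‖ = 1 := by simpa using hz
      have h3 : ∀ k ∈ Finset.range N, (w ^ k * z) ^ n = z ^ n * (w ^ n) ^ k := by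
        intro k _
        rw [mul_zpow, mul_comm, ← zpow_natCast, ← zpow_natCast, zpow_comm]
      rw [integral_zpow_toCircle hn, Finset.sum_congr rfl h3, ← Finset.mul_sum, geom_sum_eq h1,
        mul_zero, sub_zero, norm_mul, norm_zpow, hz1, one_zpow, one_mul, norm_div]
      have h4 : ‖(w ^ n) ^ N - 1‖ ≤ 2 := by
        refine (norm_sub_le _ _).trans ?_
        rw [norm_pow, norm_zpow, hw]; norm_num
      rw [div_lt_iff₀ hε] at hN₀
      calc _ ≤ 2 / ‖w ^ n - 1‖ := by gcongr
        _ ≤ N₀ * ε := hN₀.le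
        _ ≤ ε * N := by rw [mul_comm]; gcongr
  · intro f g hf hg Pf Pg ε hε
    obtain ⟨N₁, h₁⟩ := Pf (ε / 2) (by positivity)
    obtain ⟨N₂, h₂⟩ := Pg (ε / 2) (by positivity)
    refine ⟨max N₁ N₂, fun N hN z hz => ?_⟩
    have a := h₁ N (le_of_max_le_left hN) z hz
    have b := h₂ N (le_of_max_le_right hN) z hz
    rw [integral_add (integrable_comp_toCircle hf) (integrable_comp_toCircle hg),
      Finset.sum_add_distrib, mul_add, add_sub_add_comm]
    refine (norm_add_le _ _).trans ?_
    linarith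
  · intro c f hf Pf ε hε
    obtain ⟨N₁, h₁⟩ := Pf (ε / (‖c‖ + 1)) (by positivity)
    refine ⟨N₁, fun N hN z hz => ?_⟩
    have a := h₁ N hN z hz
    rw [integral_const_mul, ← Finset.mul_sum, mul_left_comm, ← mul_sub, norm_mul]
    calc _ ≤ (‖c‖ + 1) * (ε / (‖c‖ + 1) * N) := by gcongr; linarith
      _ = ε * N := by field_simp
  · intro f hf h ε hε
    obtain ⟨p, hp, Pp, hfp⟩ := h (ε / 3) (by positivity)
    obtain ⟨N₁, h₁⟩ := Pp (ε / 3) (by positivity)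
    refine ⟨N₁, fun N hN z hz => ?_⟩
    have a := h₁ N hN z hz
    have b : ‖∑ k ∈ Finset.range N, (f (w ^ k * z) - p (w ^ k * z))‖ ≤ ε / 3 * N := by
      refine (norm_sum_le_of_le _ fun k _ => hfp _ (hmem k z hz)).trans ?_
      simp [mul_comm]
    have c : ‖∫ x : UnitAddCircle, (f x.toCircle - p x.toCircle)‖ ≤ ε / 3 := by
      refine (norm_integral_le_of_norm_le_const
        (Eventually.of_forall fun x => hfp _ (toCircle_mem_sphere x))).trans ?_
      simp [measureReal_def]
    have e : ∑ k ∈ Finset.range N, f (w ^ k * z) - N * ∫ x : UnitAddCircle, f x.toCircle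
        = (∑ k ∈ Finset.range N, p (w ^ k * z) - N * ∫ x : UnitAddCircle, p x.toCircle)
          + ∑ k ∈ Finset.range N, (f (w ^ k * z) - p (w ^ k * z))
          - N * ∫ x : UnitAddCircle, (f x.toCircle - p x.toCircle) := by
      rw [integral_sub (integrable_comp_toCircle hf) (integrable_comp_toCircle hp),
        Finset.sum_sub_distrib]
      ring
    rw [e]
    have d : ‖(N : ℂ) * ∫ x : UnitAddCircle, (f x.toCircle - p x.toCircle)‖ ≤ N * (ε / 3) := by
      rw [norm_mul, Complex.norm_natCast]; gcongr
    refine (norm_sub_le _ _).trans ?_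
    have := norm_add_le (∑ k ∈ Finset.range N, p (w ^ k * z)
      - N * ∫ x : UnitAddCircle, p x.toCircle) (∑ k ∈ Finset.range N, (f (w ^ k * z) - p (w ^ k * z)))
    linarith

lemma weyl_equidistribution_real {w : ℂ} (hw : ‖w‖ = 1) (hw' : ∀ n : ℤ, n ≠ 0 → w ^ n ≠ 1)
    {f : ℂ → ℝ} (hf : ContinuousOn f (Metric.sphere (0 : ℂ) 1)) {ε : ℝ} (hε : 0 < ε) :
    ∃ N₀ : ℕ, ∀ N ≥ N₀, ∀ z ∈ Metric.sphere (0 : ℂ) 1,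
      |∑ k ∈ Finset.range N, f (w ^ k * z) - N * ∫ x : UnitAddCircle, f x.toCircle| ≤ ε * N := by
  obtain ⟨N₀, h⟩ := weyl_equidistribution hw hw' (f := fun z => (f z : ℂ))
    (Complex.continuous_ofReal.comp_continuousOn hf) ε hε
  refine ⟨N₀, fun N hN z hz => ?_⟩
  have := h N hN z hz
  rw [integral_complex_ofReal] at this
  rw [← Real.norm_eq_abs, ← Complex.norm_real]
  push_cast
  exact this

/-- Minimality of the irrational rotation: a uniform bound for the time that the orbits take to
come close to a given point. -/
lemma exists_forall_exists_norm_rotate_sub_lt {w : ℂ} (hw : ‖w‖ = 1)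
    (hw' : ∀ n : ℤ, n ≠ 0 → w ^ n ≠ 1) {z₀ : ℂ} (hz₀ : z₀ ∈ Metric.sphere (0 : ℂ) 1) {η : ℝ}
    (hη : 0 < η) :
    ∃ N : ℕ, ∀ z ∈ Metric.sphere (0 : ℂ) 1, ∃ j < N, ‖w ^ j * z - z₀‖ < η := by
  let g : ℂ → ℝ := fun z => max 0 (η - ‖z - z₀‖)
  have hg : Continuous g := by fun_prop
  have hI : 0 < ∫ x : UnitAddCircle, g x.toCircle := by
    obtain ⟨x₀, hx₀⟩ := exists_toCircle_eq hz₀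
    refine Continuous.integral_pos_of_hasCompactSupport_nonneg_nonzero (x := x₀)
      (continuous_comp_toCircle hg.continuousOn) (HasCompactSupport.of_compactSpace _)
      (fun x => le_max_left _ _) ?_
    simp [g, hx₀, hη]
  obtain ⟨N₀, h⟩ := weyl_equidistribution_real hw hw' hg.continuousOn (half_pos hI)
  refine ⟨N₀ + 1, fun z hz => ?_⟩
  by_contra! hcon
  have h1 := h (N₀ + 1) (by omega) z hz
  rw [Finset.sum_eq_zero fun j hj => max_eq_left (by linarith [hcon j (Finset.mem_range.1 hj)]),
    zero_sub, abs_neg, abs_of_nonneg (by positivity)] at h1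
  push_cast at h1
  nlinarith [mul_pos hI (by positivity : (0 : ℝ) < N₀ + 1)]

/-! ### The logarithmic mean of a function on the circle -/

/-- The logarithmic mean as an integral with respect to Haar measure. -/
lemma expIntegralLog_eq (f : ℂ → ℂ) :
    expIntegralLog f = (EReal.exp (extIntegral (volume : Measure UnitAddCircle)
      fun x => ENNReal.log ‖f x.toCircle‖ₑ)).toReal := by
  have key : ∀ F : ℂ → ℝ≥0∞, ∫⁻ x in Set.Icc (0 : ℝ) 1, F (Complex.exp (2 * Real.pi * Complex.I * x))
      = ∫⁻ x : UnitAddCircle, F x.toCircle := by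
    intro F
    rw [← UnitAddCircle.lintegral_preimage 0, zero_add, restrict_Ioc_eq_restrict_Icc]
    refine lintegral_congr fun x => ?_
    rw [AddCircle.toCircle_apply_mk, Circle.coe_exp]
    congr 2
    push_cast
    ring
  unfold expIntegralLog extIntegral
  rw [key fun z => (ENNReal.log ‖f z‖ₑ).toENNReal, key fun z => (-ENNReal.log ‖f z‖ₑ).toENNReal]

lemma expIntegralLog_nonneg (f : ℂ → ℂ) : 0 ≤ expIntegralLog f := ENNReal.toReal_nonneg

/-- This includes `c = 0`, where `log 0 = ⊥` has positive part `0` and `Real.log 0 = 0`. -/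
lemma toENNReal_log_enorm (c : ℂ) :
    (ENNReal.log ‖c‖ₑ).toENNReal = ENNReal.ofReal (Real.log ‖c‖) := by
  rcases eq_or_ne c 0 with rfl | hc
  · simp
  · rw [← ofReal_norm, ENNReal.log_ofReal_of_pos (norm_pos_iff.2 hc), EReal.real_coe_toENNReal]

lemma toENNReal_neg_log_enorm {c : ℂ} (hc : c ≠ 0) :
    (-ENNReal.log ‖c‖ₑ).toENNReal = ENNReal.ofReal (-Real.log ‖c‖) := by
  rw [← ofReal_norm, ENNReal.log_ofReal_of_pos (norm_pos_iff.2 hc), ← EReal.coe_neg,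
    EReal.real_coe_toENNReal]

section

variable {f : ℂ → ℂ}

lemma exists_norm_le_of_continuousOn_sphere (hf : ContinuousOn f (Metric.sphere (0 : ℂ) 1)) :
    ∃ M : ℝ, 1 ≤ M ∧ ∀ z ∈ Metric.sphere (0 : ℂ) 1, ‖f z‖ ≤ M := by
  obtain ⟨M, hM⟩ := (isCompact_sphere (0 : ℂ) 1).exists_bound_of_continuousOn hf
  exact ⟨max 1 M, le_max_left _ _, fun z hz => (hM z hz).trans (le_max_right _ _)⟩

lemma lintegral_log_pos_part_lt_top (hf : ContinuousOn f (Metric.sphere (0 : ℂ) 1)) :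
    ∫⁻ x : UnitAddCircle, ENNReal.ofReal (Real.log ‖f x.toCircle‖) < ∞ := by
  obtain ⟨M, hM1, hM⟩ := exists_norm_le_of_continuousOn_sphere hf
  refine (lintegral_mono (g := fun _ => ENNReal.ofReal M) fun x => ENNReal.ofReal_le_ofReal ?_).trans_lt
    (by simp)
  exact (Real.log_le_self (norm_nonneg _)).trans (hM _ (toCircle_mem_sphere x))

lemma expIntegralLog_eq' (f : ℂ → ℂ) :
    expIntegralLog f = (EReal.exp
      (((∫⁻ x : UnitAddCircle, ENNReal.ofReal (Real.log ‖f x.toCircle‖) : ℝ≥0∞) : EReal)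
        - ((∫⁻ x : UnitAddCircle, (-ENNReal.log ‖f x.toCircle‖ₑ).toENNReal : ℝ≥0∞) : EReal))).toReal := by
  rw [expIntegralLog_eq, extIntegral]
  simp_rw [toENNReal_log_enorm]

lemma measurable_norm_comp_toCircle (hf : ContinuousOn f (Metric.sphere (0 : ℂ) 1)) :
    Measurable fun x : UnitAddCircle => ‖f x.toCircle‖ :=
  (continuous_comp_toCircle hf).norm.measurable

lemma measurable_neg_log (hf : ContinuousOn f (Metric.sphere (0 : ℂ) 1)) :
    Measurable fun x : UnitAddCircle => (-ENNReal.log ‖f x.toCircle‖ₑ).toENNReal :=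
  ((continuous_comp_toCircle hf).enorm.measurable.ennreal_log.neg).ereal_toENNReal

/-- If the negative part of `log ‖f‖` has finite integral, then `f` has almost no zeros, and the
extended-real integral of `log ‖f‖` is the ordinary one. -/
lemma expIntegralLog_eq_exp_integral (hf : ContinuousOn f (Metric.sphere (0 : ℂ) 1))
    (hq : ∫⁻ x : UnitAddCircle, (-ENNReal.log ‖f x.toCircle‖ₑ).toENNReal ≠ ∞) :
    Integrable (fun x : UnitAddCircle => Real.log ‖f x.toCircle‖) ∧
      (∀ᵐ x : UnitAddCircle, f x.toCircle ≠ 0) ∧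
      expIntegralLog f = Real.exp (∫ x : UnitAddCircle, Real.log ‖f x.toCircle‖) := by
  have hp := lintegral_log_pos_part_lt_top hf
  have h0 : ∀ᵐ x : UnitAddCircle, f x.toCircle ≠ 0 := by
    filter_upwards [ae_lt_top (measurable_neg_log hf) hq] with x hx h
    simp [h] at hx
  have hq' : ∫⁻ x : UnitAddCircle, (-ENNReal.log ‖f x.toCircle‖ₑ).toENNReal
      = ∫⁻ x : UnitAddCircle, ENNReal.ofReal (-Real.log ‖f x.toCircle‖) :=
    lintegral_congr_ae (h0.mono fun x hx => toENNReal_neg_log_enorm hx)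
  have hm : Measurable fun x : UnitAddCircle => Real.log ‖f x.toCircle‖ :=
    (measurable_norm_comp_toCircle hf).log
  have hint : Integrable fun x : UnitAddCircle => Real.log ‖f x.toCircle‖ := by
    refine ⟨hm.aestronglyMeasurable, ?_⟩
    rw [hasFiniteIntegral_iff_norm]
    have : ∀ x : UnitAddCircle, ENNReal.ofReal ‖Real.log ‖f x.toCircle‖‖
        = ENNReal.ofReal (Real.log ‖f x.toCircle‖) + ENNReal.ofReal (-Real.log ‖f x.toCircle‖) := by
      intro x
      rcases le_total 0 (Real.log ‖f x.toCircle‖) with h | h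
      · rw [Real.norm_of_nonneg h, ENNReal.ofReal_of_nonpos (neg_nonpos.2 h), add_zero]
      · rw [Real.norm_of_nonpos h, ENNReal.ofReal_of_nonpos h, zero_add]
    simp_rw [this]
    rw [lintegral_add_left hm.ennreal_ofReal]
    exact ENNReal.add_lt_top.2 ⟨hp, by rw [← hq']; exact hq.lt_top⟩
  refine ⟨hint, h0, ?_⟩
  rw [expIntegralLog_eq', integral_eq_lintegral_pos_part_sub_lintegral_neg_part hint, ← hq',
    ← EReal.coe_ennreal_toReal hp.ne, ← EReal.coe_ennreal_toReal hq, ← EReal.coe_sub,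
    EReal.exp_coe, ENNReal.toReal_ofReal (Real.exp_pos _).le]

lemma lintegral_neg_log_ne_top_of_pos (h : 0 < expIntegralLog f)
    (hf : ContinuousOn f (Metric.sphere (0 : ℂ) 1)) :
    ∫⁻ x : UnitAddCircle, (-ENNReal.log ‖f x.toCircle‖ₑ).toENNReal ≠ ∞ := by
  intro hq
  rw [expIntegralLog_eq', hq, ← EReal.coe_ennreal_toReal (lintegral_log_pos_part_lt_top hf).ne] at h
  simp at h

lemma lintegral_neg_log_ne_top_of_ne_zero (hf : ContinuousOn f (Metric.sphere (0 : ℂ) 1))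
    (h0 : ∀ z ∈ Metric.sphere (0 : ℂ) 1, f z ≠ 0) :
    ∫⁻ x : UnitAddCircle, (-ENNReal.log ‖f x.toCircle‖ₑ).toENNReal ≠ ∞ := by
  have h := lintegral_log_pos_part_lt_top (hf.inv₀ h0)
  have h' : ∀ x : UnitAddCircle, (-ENNReal.log ‖f x.toCircle‖ₑ).toENNReal
      = ENNReal.ofReal (Real.log ‖(f x.toCircle)⁻¹‖) := fun x => by
    rw [toENNReal_neg_log_enorm (h0 _ (toCircle_mem_sphere x)), norm_inv, Real.log_inv]
  simp_rw [h']
  exact h.ne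

lemma continuousOn_log_max (hf : ContinuousOn f (Metric.sphere (0 : ℂ) 1)) {ε : ℝ} (hε : 0 < ε) :
    ContinuousOn (fun z => Real.log (max ‖f z‖ ε)) (Metric.sphere (0 : ℂ) 1) :=
  (hf.norm.sup continuousOn_const).log fun _ _ => (lt_max_of_lt_right hε).ne'

/-- The truncations `max ‖f‖ ε` have logarithmic means that decrease to that of `‖f‖`. -/
lemma exists_integral_log_max_lt (hf : ContinuousOn f (Metric.sphere (0 : ℂ) 1)) {r : ℝ}
    (hr : expIntegralLog f < r) :
    ∃ ε > 0, ∫ x : UnitAddCircle, Real.log (max ‖f x.toCircle‖ ε) < Real.log r := by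
  by_contra! hcon
  have hr0 : 0 < r := (expIntegralLog_nonneg f).trans_lt hr
  set p := ∫⁻ x : UnitAddCircle, ENNReal.ofReal (Real.log ‖f x.toCircle‖) with hpdef
  have hp : p < ∞ := lintegral_log_pos_part_lt_top hf
  let e : ℕ → ℝ := fun n => 1 / ((n : ℝ) + 1)
  have he : ∀ n, 0 < e n := fun n => by positivity
  have he1 : ∀ n, e n ≤ 1 := fun n => by
    rw [div_le_one (by positivity)]; linarith [(Nat.cast_nonneg n : (0 : ℝ) ≤ n)]
  let q : ℕ → UnitAddCircle → ℝ≥0∞ := fun n x => ENNReal.ofReal (-Real.log (max ‖f x.toCircle‖ (e n)))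
  have hqm : ∀ n, Measurable (q n) := fun n =>
    ((((measurable_norm_comp_toCircle hf).max measurable_const).log).neg).ennreal_ofReal
  have hbound : ∀ n, ∫⁻ x, q n x ≤ ENNReal.ofReal (p.toReal - Real.log r) := by
    intro n
    have hint := integrable_comp_toCircle (continuousOn_log_max hf (he n))
    have h1 := hcon (e n) (he n)
    have hpn : ∫⁻ x : UnitAddCircle, ENNReal.ofReal (Real.log (max ‖f x.toCircle‖ (e n))) = p := by
      refine lintegral_congr fun x => ?_
      rcases le_total ‖f x.toCircle‖ (e n) with h | h
      · rw [max_eq_right h, ENNReal.ofReal_of_nonpos (Real.log_nonpos (he n).le (he1 n)),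
          ENNReal.ofReal_of_nonpos (Real.log_nonpos (norm_nonneg _) (h.trans (he1 n)))]
      · rw [max_eq_left h]
    rw [integral_eq_lintegral_pos_part_sub_lintegral_neg_part hint, hpn] at h1
    have hfin : ∫⁻ x, q n x ≠ ∞ := hint.neg.lintegral_lt_top.ne
    rw [← ENNReal.ofReal_toReal hfin]
    exact ENNReal.ofReal_le_ofReal (by linarith)
  -- Fatou's lemma carries the bound over to the limit, which is infinite at the zeros of `f`.
  have hle : ∫⁻ x : UnitAddCircle, (-ENNReal.log ‖f x.toCircle‖ₑ).toENNReal
      ≤ ENNReal.ofReal (p.toReal - Real.log r) := by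
    have hlim : ∀ x : UnitAddCircle,
        (-ENNReal.log ‖f x.toCircle‖ₑ).toENNReal = liminf (fun n => q n x) atTop := by
      intro x
      refine (Tendsto.liminf_eq ?_).symm
      have he0 : Tendsto e atTop (𝓝 0) := tendsto_one_div_add_atTop_nhds_zero_nat
      rcases eq_or_ne (f x.toCircle) 0 with h | h
      · have : ∀ n, q n x = ENNReal.ofReal (Real.log ((n : ℝ) + 1)) := by
          intro n
          simp only [q, h, norm_zero, max_eq_right (he n).le]
          simp [e]
        simp_rw [this, h]
        simp only [enorm_zero, ENNReal.log_zero, EReal.neg_bot, EReal.toENNReal_top]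
        refine ENNReal.tendsto_ofReal_atTop.comp (Real.tendsto_log_atTop.comp ?_)
        exact tendsto_atTop_add_const_right _ _ tendsto_natCast_atTop_atTop
      · rw [toENNReal_neg_log_enorm h]
        refine (ENNReal.continuous_ofReal.tendsto _).comp (Tendsto.neg ?_)
        have : Tendsto (fun n => max ‖f x.toCircle‖ (e n)) atTop (𝓝 (max ‖f x.toCircle‖ 0)) :=
          tendsto_const_nhds.max he0
        rw [max_eq_left (norm_nonneg _)] at this
        exact this.log (norm_ne_zero_iff.2 h)
    simp_rw [hlim]
    refine (lintegral_liminf_le hqm).trans ?_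
    exact liminf_le_of_le (by isBoundedDefault) fun b hb => by
      obtain ⟨n, hn⟩ := hb.exists
      exact hn.trans (hbound n)
  have hq : ∫⁻ x : UnitAddCircle, (-ENNReal.log ‖f x.toCircle‖ₑ).toENNReal ≠ ∞ :=
    (hle.trans_lt ENNReal.ofReal_lt_top).ne
  obtain ⟨hint, h0, hD⟩ := expIntegralLog_eq_exp_integral hf hq
  have hcmp : Real.log r ≤ ∫ x : UnitAddCircle, Real.log ‖f x.toCircle‖ := by
    have hcongr : ∫⁻ x : UnitAddCircle, (-ENNReal.log ‖f x.toCircle‖ₑ).toENNReal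
        = ∫⁻ x : UnitAddCircle, ENNReal.ofReal (-Real.log ‖f x.toCircle‖) :=
      lintegral_congr_ae (h0.mono fun x hx => toENNReal_neg_log_enorm hx)
    have hnn : 0 ≤ p.toReal - Real.log r := by
      have h1 := hcon 1 one_pos
      have hint1 := integrable_comp_toCircle (continuousOn_log_max hf one_pos)
      rw [integral_eq_lintegral_pos_part_sub_lintegral_neg_part hint1] at h1
      have hpn : ∫⁻ x : UnitAddCircle, ENNReal.ofReal (Real.log (max ‖f x.toCircle‖ 1)) ≤ p := by
        refine lintegral_mono fun x => ?_
        rcases le_total ‖f x.toCircle‖ 1 with h | h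
        · simp [max_eq_right h]
        · simp [max_eq_left h]
      have h2 := ENNReal.toReal_mono hp.ne hpn
      have h3 := @ENNReal.toReal_nonneg
        (∫⁻ x : UnitAddCircle, ENNReal.ofReal (-Real.log (max ‖f x.toCircle‖ 1)))
      linarith
    have h4 := ENNReal.toReal_mono ENNReal.ofReal_ne_top hle
    rw [ENNReal.toReal_ofReal hnn, hcongr] at h4
    rw [integral_eq_lintegral_pos_part_sub_lintegral_neg_part hint]
    linarith
  rw [hD] at hr
  have := (Real.exp_le_exp.2 hcmp).trans_lt hr
  rw [Real.exp_log hr0] at this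
  exact lt_irrefl _ this

/-! ### Growth of the cocycle `∏ k < m, f (w ^ k * z)` -/

lemma mem_sphere_rotate {w : ℂ} (hw : ‖w‖ = 1) (k : ℕ) {z : ℂ}
    (hz : z ∈ Metric.sphere (0 : ℂ) 1) : w ^ k * z ∈ Metric.sphere (0 : ℂ) 1 := by
  simpa [hw] using hz

/-- Uniform upper bound for the cocycle: `log ‖f‖` lies below a continuous function whose mean is
less than `log r`, and the ergodic averages of that function converge uniformly. -/
lemma exists_norm_prod_lt_pow {w : ℂ} (hw : ‖w‖ = 1) (hw' : ∀ n : ℤ, n ≠ 0 → w ^ n ≠ 1)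
    (hf : ContinuousOn f (Metric.sphere (0 : ℂ) 1)) {r : ℝ} (hr : expIntegralLog f < r) :
    ∃ m : ℕ, ∀ z ∈ Metric.sphere (0 : ℂ) 1,
      ‖∏ k ∈ Finset.range m, f (w ^ k * z)‖ < r ^ m := by
  have hr0 : 0 < r := (expIntegralLog_nonneg f).trans_lt hr
  obtain ⟨ε, hε, hlt⟩ := exists_integral_log_max_lt hf hr
  obtain ⟨N₀, hN⟩ := weyl_equidistribution_real hw hw' (continuousOn_log_max hf hε)
    (half_pos (sub_pos.2 hlt))
  refine ⟨N₀ + 1, fun z hz => ?_⟩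
  have h1 := (abs_le.1 (hN (N₀ + 1) (by omega) z hz)).2
  have hpos : (0 : ℝ) < (N₀ + 1 : ℕ) := by positivity
  have hmax : ∀ z, 0 < max ‖f z‖ ε := fun z => lt_max_of_lt_right hε
  have h2 : ∑ k ∈ Finset.range (N₀ + 1), Real.log (max ‖f (w ^ k * z)‖ ε)
      < (N₀ + 1 : ℕ) * Real.log r := by nlinarith
  calc ‖∏ k ∈ Finset.range (N₀ + 1), f (w ^ k * z)‖
      = ∏ k ∈ Finset.range (N₀ + 1), ‖f (w ^ k * z)‖ := norm_prod _ _
    _ ≤ ∏ k ∈ Finset.range (N₀ + 1), max ‖f (w ^ k * z)‖ ε :=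
        Finset.prod_le_prod (fun _ _ => norm_nonneg _) fun _ _ => le_max_left _ _
    _ = Real.exp (∑ k ∈ Finset.range (N₀ + 1), Real.log (max ‖f (w ^ k * z)‖ ε)) := by
        rw [Real.exp_sum]
        exact Finset.prod_congr rfl fun k _ => (Real.exp_log (hmax _)).symm
    _ < Real.exp ((N₀ + 1 : ℕ) * Real.log r) := Real.exp_lt_exp.2 h2
    _ = r ^ (N₀ + 1) := by rw [Real.exp_nat_mul, Real.exp_log hr0]

/-- Uniform lower bound for the cocycle of a function without zeros, for which `log ‖f‖` is itself
continuous. -/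
lemma exists_pow_lt_norm_prod {w : ℂ} (hw : ‖w‖ = 1) (hw' : ∀ n : ℤ, n ≠ 0 → w ^ n ≠ 1)
    (hf : ContinuousOn f (Metric.sphere (0 : ℂ) 1)) (h0 : ∀ z ∈ Metric.sphere (0 : ℂ) 1, f z ≠ 0)
    {r : ℝ} (hr0 : 0 < r) (hr : r < expIntegralLog f) :
    ∃ m : ℕ, ∀ z ∈ Metric.sphere (0 : ℂ) 1,
      r ^ m < ‖∏ k ∈ Finset.range m, f (w ^ k * z)‖ := by
  obtain ⟨-, -, hD⟩ :=
    expIntegralLog_eq_exp_integral hf (lintegral_neg_log_ne_top_of_ne_zero hf h0)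
  rw [hD, ← Real.log_lt_iff_lt_exp hr0] at hr
  obtain ⟨N₀, hN⟩ := weyl_equidistribution_real hw hw'
    (hf.norm.log fun z hz => norm_ne_zero_iff.2 (h0 z hz)) (half_pos (sub_pos.2 hr))
  refine ⟨N₀ + 1, fun z hz => ?_⟩
  have h1 := (abs_le.1 (hN (N₀ + 1) (by omega) z hz)).1
  have hpos : (0 : ℝ) < (N₀ + 1 : ℕ) := by positivity
  have h2 : (N₀ + 1 : ℕ) * Real.log r
      < ∑ k ∈ Finset.range (N₀ + 1), Real.log ‖f (w ^ k * z)‖ := by nlinarith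
  calc r ^ (N₀ + 1) = Real.exp ((N₀ + 1 : ℕ) * Real.log r) := by
        rw [Real.exp_nat_mul, Real.exp_log hr0]
    _ < Real.exp (∑ k ∈ Finset.range (N₀ + 1), Real.log ‖f (w ^ k * z)‖) := Real.exp_lt_exp.2 h2
    _ = ∏ k ∈ Finset.range (N₀ + 1), ‖f (w ^ k * z)‖ := by
        rw [Real.exp_sum]
        exact Finset.prod_congr rfl fun k _ =>
          Real.exp_log (norm_pos_iff.2 (h0 _ (mem_sphere_rotate hw k hz)))
    _ = _ := (norm_prod _ _).symm

/-- Lower bound for the supremum of the cocycle: its logarithm has mean `m` times that of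
`log ‖f‖`, by rotation invariance. -/
lemma pow_le_of_norm_prod_le {w : ℂ} (hw : ‖w‖ = 1) (hf : ContinuousOn f (Metric.sphere (0 : ℂ) 1))
    {m : ℕ} {K : ℝ}
    (hK : ∀ z ∈ Metric.sphere (0 : ℂ) 1, ‖∏ k ∈ Finset.range m, f (w ^ k * z)‖ ≤ K) :
    expIntegralLog f ^ m ≤ K := by
  rcases (expIntegralLog_nonneg f).eq_or_lt with hD | hD
  · rw [← hD]
    have hK1 := hK 1 (by simp)
    rcases eq_or_ne m 0 with rfl | hm
    · simpa using hK1
    · rw [zero_pow hm]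
      exact (norm_nonneg _).trans hK1
  obtain ⟨hint, h0, hexp⟩ :=
    expIntegralLog_eq_exp_integral hf (lintegral_neg_log_ne_top_of_pos hD hf)
  obtain ⟨t, ht⟩ := exists_toCircle_eq (z := w) (by simpa using hw)
  have hrot : ∀ (k : ℕ) (x : UnitAddCircle), w ^ k * (x.toCircle : ℂ) = (x + k • t).toCircle := by
    intro k x
    rw [AddCircle.toCircle_add, AddCircle.toCircle_nsmul, Circle.coe_mul, Circle.coe_pow, ht,
      mul_comm]
  have hmp : ∀ k : ℕ, MeasurePreserving (fun x : UnitAddCircle => x + k • t) :=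
    fun k => measurePreserving_add_right volume (k • t)
  have hintk : ∀ k : ℕ, Integrable fun x : UnitAddCircle => Real.log ‖f (w ^ k * x.toCircle)‖ := by
    intro k
    simp_rw [hrot k]
    exact (hmp k).integrable_comp_of_integrable
      (g := fun x : UnitAddCircle => Real.log ‖f x.toCircle‖) hint
  have h0k : ∀ᵐ x : UnitAddCircle, ∀ k : ℕ, f (w ^ k * x.toCircle) ≠ 0 := by
    rw [ae_all_iff]
    intro k
    simp_rw [hrot k]
    exact (hmp k).quasiMeasurePreserving.ae (p := fun x : UnitAddCircle => f x.toCircle ≠ 0) h0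
  have hKpos : 0 < K := by
    obtain ⟨x, hx⟩ := h0k.exists
    exact (norm_pos_iff.2 (Finset.prod_ne_zero_iff.2 fun k _ => hx k)).trans_le
      (hK _ (toCircle_mem_sphere x))
  have hle : m * ∫ x : UnitAddCircle, Real.log ‖f x.toCircle‖ ≤ Real.log K := by
    have h1 : ∫ x : UnitAddCircle, ∑ k ∈ Finset.range m, Real.log ‖f (w ^ k * x.toCircle)‖
        = m * ∫ x : UnitAddCircle, Real.log ‖f x.toCircle‖ := by
      rw [integral_finsetSum _ fun k _ => hintk k]
      have h2 : ∀ k ∈ Finset.range m, ∫ x : UnitAddCircle, Real.log ‖f (w ^ k * x.toCircle)‖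
          = ∫ x : UnitAddCircle, Real.log ‖f x.toCircle‖ := by
        intro k _
        simp_rw [hrot k]
        exact integral_add_right_eq_self
          (fun x : UnitAddCircle => Real.log ‖f x.toCircle‖) (k • t)
      rw [Finset.sum_congr rfl h2]
      simp
    rw [← h1]
    have h3 : ∫ _ : UnitAddCircle, Real.log K = Real.log K := by simp [measureReal_def]
    rw [← h3]
    refine integral_mono_ae (integrable_finsetSum _ fun k _ => hintk k) (integrable_const _) ?_
    filter_upwards [h0k] with x hx
    rw [← Real.log_prod fun k _ => norm_ne_zero_iff.2 (hx k), ← norm_prod]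
    exact Real.log_le_log (norm_pos_iff.2 (Finset.prod_ne_zero_iff.2 fun k _ => hx k))
      (hK _ (toCircle_mem_sphere x))
  rw [hexp, ← Real.exp_nat_mul, ← Real.exp_log hKpos]
  exact Real.exp_le_exp.2 hle

end

/-! ### Tracial states -/

section Trace

variable {A : Type*} [CStarAlgebra A] (τ : TracialState A)

lemma trace_conj_symm (a b : A) :
    (starRingEnd ℂ) (τ.toLinearMap (star b * a)) = τ.toLinearMap (star a * b) := by
  have h1 := τ.im_eq_zero' (a + b)
  have h2 := τ.im_eq_zero' (a + Complex.I • b)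
  have h3 := τ.im_eq_zero' a
  have h4 := τ.im_eq_zero' b
  simp only [LinearMap.coe_toAddHom, AddHom.toFun_eq_coe, star_add, star_smul, add_mul, mul_add,
    map_add, Complex.add_im, smul_mul_assoc, mul_smul_comm, map_smul, smul_eq_mul] at h1 h2 h3 h4
  apply Complex.ext
  · simp at h2 ⊢
    linarith
  · simp at h1 ⊢
    linarith

/-- The positive semidefinite sesquilinear form `⟪a, b⟫ = τ (a* b)`. -/
@[reducible] noncomputable def traceCore : PreInnerProductSpace.Core ℂ A where
  inner a b := τ.toLinearMap (star a * b)
  conj_inner_symm a b := trace_conj_symm τ a b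
  re_inner_nonneg a := τ.nonneg_re' a
  add_left a b c := by simp [add_mul]
  smul_left a b r := by simp

/-- The `L²`-seminorm `‖a‖₂ = τ(a* a)^{1/2}`. -/
noncomputable def traceNorm (a : A) : ℝ := Real.sqrt (τ.toLinearMap (star a * a)).re

lemma traceNorm_nonneg (a : A) : 0 ≤ traceNorm τ a := Real.sqrt_nonneg _

lemma trace_star_mul_self (a : A) : τ.toLinearMap (star a * a) = ((traceNorm τ a ^ 2 : ℝ) : ℂ) := by
  rw [traceNorm, Real.sq_sqrt (show 0 ≤ (τ.toLinearMap (star a * a)).re from τ.nonneg_re' a)]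
  exact Complex.ext rfl (τ.im_eq_zero' a)

lemma norm_trace_star_mul_le (a b : A) :
    ‖τ.toLinearMap (star a * b)‖ ≤ traceNorm τ a * traceNorm τ b :=
  letI := traceCore τ
  InnerProductSpace.Core.norm_inner_le_norm (𝕜 := ℂ) a b

lemma traceNorm_mul_le (x a : A) : traceNorm τ (x * a) ≤ ‖x‖ * traceNorm τ a := by
  let _ := CStarAlgebra.spectralOrder A
  have _ := CStarAlgebra.spectralOrderedRing A
  have h : star x * x ≤ algebraMap ℝ A (‖x‖ ^ 2) := by
    rw [pow_two, ← CStarRing.norm_star_mul_self]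
    exact (IsSelfAdjoint.star_mul_self x).le_algebraMap_norm_self
  obtain ⟨y, hy⟩ := CStarAlgebra.nonneg_iff_eq_star_mul_self.1 (sub_nonneg.2 h)
  have h2 : star (y * a) * (y * a) = ((‖x‖ ^ 2 : ℝ) : ℂ) • (star a * a) - star (x * a) * (x * a) := by
    rw [star_mul, star_mul, mul_assoc, ← mul_assoc (star y), ← hy, mul_assoc (star a),
      ← mul_assoc (star x), sub_mul, mul_sub, Algebra.algebraMap_eq_smul_one, smul_mul_assoc,
      one_mul, mul_smul_comm, Complex.coe_smul]
  have h3 := τ.nonneg_re' (y * a)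
  rw [h2] at h3
  simp only [LinearMap.coe_toAddHom, AddHom.toFun_eq_coe, map_sub, map_smul, smul_eq_mul] at h3
  rw [trace_star_mul_self, trace_star_mul_self, ← Complex.ofReal_mul, ← Complex.ofReal_sub,
    Complex.ofReal_re] at h3
  refine (sq_le_sq₀ (traceNorm_nonneg τ _)
    (mul_nonneg (norm_nonneg _) (traceNorm_nonneg τ a))).1 ?_
  linarith [mul_pow ‖x‖ (traceNorm τ a) 2]

lemma traceNorm_one : traceNorm τ 1 = 1 := by
  have h : τ.toLinearMap 1 = 1 := τ.map_one'
  simp [traceNorm, h]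

lemma norm_trace_le (a : A) : ‖τ.toLinearMap a‖ ≤ ‖a‖ := by
  have h := norm_trace_star_mul_le τ 1 (a * 1)
  have h2 := traceNorm_mul_le τ a 1
  rw [traceNorm_one] at h h2
  simp only [star_one, one_mul, mul_one] at h h2
  exact h.trans h2

lemma nontrivial_of_tracialState (τ : TracialState A) : Nontrivial A :=
  ⟨⟨0, 1, fun h => by
    have h1 : τ.toLinearMap 1 = 1 := τ.map_one'
    rw [← h, map_zero] at h1
    exact zero_ne_one h1⟩⟩

/-- The trace vanishes on the eigenvectors of an inner automorphism, except for the
eigenvalue `1`. -/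
lemma trace_eq_zero_of_mul_eq_smul {v x : A} (hv : v ∈ unitary A) {c : ℂ} (hc : c ≠ 1)
    (h : v * x = c • (x * v)) : τ.toLinearMap x = 0 := by
  have h1 : τ.toLinearMap x = c * τ.toLinearMap x := by
    calc τ.toLinearMap x = τ.toLinearMap ((star v * v) * x) := by
          rw [Unitary.star_mul_self_of_mem hv, one_mul]
      _ = c * τ.toLinearMap (star v * (x * v)) := by
          rw [mul_assoc, h, mul_smul_comm, map_smul, smul_eq_mul]
      _ = c * τ.toLinearMap x := by
          have := τ.tracial' (star v) (x * v)
          simp only [LinearMap.coe_toAddHom, AddHom.toFun_eq_coe] at this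
          rw [this, mul_assoc, Unitary.mul_star_self_of_mem hv, mul_one]
  have h2 : (1 - c) * τ.toLinearMap x = 0 := by linear_combination h1
  exact (mul_eq_zero.1 h2).resolve_left (sub_ne_zero.2 hc.symm)

end Trace

/-! ### Functional calculus of a unitary in a rotation algebra -/

section Calculus

variable {A : Type*} [CStarAlgebra A] {u v : A} {w : ℂ}

lemma mul_pow_eq_smul {a : A} (h : v * a = w • (a * v)) (k : ℕ) :
    v * a ^ k = w ^ k • (a ^ k * v) := by
  induction k with
  | zero => simp
  | succ k ih =>
    rw [pow_succ, ← mul_assoc, ih, smul_mul_assoc, mul_assoc (a ^ k), h, mul_smul_comm, smul_smul,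
      pow_succ, mul_assoc (a ^ k)]

lemma mul_star_eq_smul (hu : u ∈ unitary A) (hw : ‖w‖ = 1) (hrel : v * u = w • (u * v)) :
    v * star u = w⁻¹ • (star u * v) := by
  have hw0 : w ≠ 0 := norm_ne_zero_iff.1 (by rw [hw]; exact one_ne_zero)
  have h1 : star u * v * u = w • v := by
    rw [mul_assoc, hrel, mul_smul_comm, ← mul_assoc, Unitary.star_mul_self_of_mem hu, one_mul]
  have h2 : star u * v = w • (v * star u) := by
    rw [← smul_mul_assoc, ← h1, mul_assoc, Unitary.mul_star_self_of_mem hu, mul_one]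
  rw [h2, smul_smul, inv_mul_cancel₀ hw0, one_smul]

/-- An element that an inner automorphism multiplies by `w` has a `w`-invariant spectrum. -/
lemma smul_mem_spectrum_of_mul_eq_smul {x a : A} (hx : x ∈ unitary A) (hw : ‖w‖ = 1)
    (h : x * a = w • (a * x)) {c : ℂ} (hc : c ∈ spectrum ℂ a) : w * c ∈ spectrum ℂ a := by
  have hw0 : w ≠ 0 := norm_ne_zero_iff.1 (by rw [hw]; exact one_ne_zero)
  have h1 : x * a * star x = w • a := by
    rw [h, smul_mul_assoc, mul_assoc, Unitary.mul_star_self_of_mem hx, mul_one]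
  have h2 := @spectrum.units_conjugate ℂ A _ _ _ a
    ⟨x, star x, Unitary.mul_star_self_of_mem hx, Unitary.star_mul_self_of_mem hx⟩
  rw [← h2]
  change w * c ∈ spectrum ℂ (x * a * star x)
  rw [h1]
  exact (spectrum.smul_mem_smul_iff (r := Units.mk0 w hw0)).2 hc

/-- A closed set that an irrational rotation maps to itself is a union of circles. -/
lemma mem_of_norm_eq {K : Set ℂ} (hK : IsClosed K) (hw : ‖w‖ = 1)
    (hw' : ∀ n : ℤ, n ≠ 0 → w ^ n ≠ 1) (h : ∀ c ∈ K, w * c ∈ K) {c d : ℂ} (hc : c ∈ K)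
    (hd : ‖d‖ = ‖c‖) : d ∈ K := by
  rcases eq_or_ne c 0 with rfl | hc0
  · rw [norm_zero, norm_eq_zero] at hd
    rwa [hd]
  have hpow : ∀ j : ℕ, w ^ j * c ∈ K := by
    intro j
    induction j with
    | zero => simpa using hc
    | succ j ih => rw [pow_succ', mul_assoc]; exact h _ ih
  have hcn : 0 < ‖c‖ := norm_pos_iff.2 hc0
  rw [← hK.closure_eq, Metric.mem_closure_iff]
  intro ε hε
  obtain ⟨N, hN⟩ := exists_forall_exists_norm_rotate_sub_lt hw hw' (z₀ := d / c)
    (by simp [hd, hc0]) (div_pos hε hcn)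
  obtain ⟨j, -, hj⟩ := hN 1 (by simp)
  refine ⟨_, hpow j, ?_⟩
  rw [dist_comm, dist_eq_norm]
  have : w ^ j * c - d = (w ^ j * 1 - d / c) * c := by field_simp
  rw [this, norm_mul]
  exact (lt_div_iff₀ hcn).1 hj

lemma spectrum_eq_sphere [Nontrivial A] (hu : u ∈ unitary A) (hv : v ∈ unitary A) (hw : ‖w‖ = 1)
    (hw' : ∀ n : ℤ, n ≠ 0 → w ^ n ≠ 1) (hrel : v * u = w • (u * v)) :
    spectrum ℂ v = Metric.sphere 0 1 := by
  have hsub := spectrum.subset_circle_of_unitary (𝕜 := ℂ) hv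
  refine hsub.antisymm fun z hz => ?_
  obtain ⟨c, hc⟩ := spectrum.nonempty v
  refine mem_of_norm_eq (spectrum.isClosed v) hw hw' (fun c hc => ?_) hc ?_
  · refine smul_mem_spectrum_of_mul_eq_smul (Unitary.star_mem hu) hw ?_ hc
    rw [mul_star_eq_smul hu hw hrel, smul_smul, mul_inv_cancel₀, one_smul]
    exact norm_ne_zero_iff.1 (by rw [hw]; exact one_ne_zero)
  · rw [mem_sphere_zero_iff_norm.1 hz, mem_sphere_zero_iff_norm.1 (hsub hc)]

variable {f g : ℂ → ℂ}

/-- The covariance relation `f(v) u = u f(w v)`. -/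
lemma cfc_mul_eq_mul_cfc_rotate (hu : u ∈ unitary A) (hv : v ∈ unitary A) (hw : ‖w‖ = 1)
    (hspec : spectrum ℂ v = Metric.sphere 0 1) (hrel : v * u = w • (u * v))
    (hf : ContinuousOn f (Metric.sphere (0 : ℂ) 1)) :
    cfc f v * u = u * cfc (fun z => f (w * z)) v := by
  have hvn : IsStarNormal v := isStarNormal_of_mem_unitary hv
  have hwv : IsStarNormal (w • v) := by
    constructor
    rw [star_smul]
    exact (hvn.star_comm_self.smul_left _).smul_right _
  have himg : (fun z => w * z) '' spectrum ℂ v ⊆ Metric.sphere 0 1 := by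
    rintro _ ⟨z, hz, rfl⟩
    rw [hspec] at hz
    simpa [hw] using hz
  let φ := Unitary.conjStarAlgAut ℂ A (⟨star u, Unitary.star_mem hu⟩ : unitary A)
  have hφ : ∀ x, φ x = star u * x * u := fun x => by
    simp [φ, Unitary.conjStarAlgAut_apply]
  have hφv : φ v = w • v := by
    rw [hφ, mul_assoc, hrel, mul_smul_comm, ← mul_assoc, Unitary.star_mul_self_of_mem hu, one_mul]
  have hφc : Continuous φ := by
    have : (φ : A → A) = fun x => star u * x * u := funext hφ
    rw [this]
    fun_prop
  have h1 : φ (cfc f v) = cfc (fun z => f (w * z)) v := by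
    rw [StarAlgHomClass.map_cfc (S := ℂ) φ f v (by rwa [hspec]) hφc hvn (by rwa [hφv]), hφv,
      cfc_comp_const_mul w f v (hf.mono himg) hvn]
  rw [← h1, hφ, ← mul_assoc, ← mul_assoc, Unitary.mul_star_self_of_mem hu, one_mul]

lemma continuousOn_rotate (hw : ‖w‖ = 1) (hf : ContinuousOn f (Metric.sphere (0 : ℂ) 1)) :
    ContinuousOn (fun z => f (w * z)) (Metric.sphere (0 : ℂ) 1) :=
  hf.comp (by fun_prop) fun z hz => by simpa [hw] using hz

lemma continuousOn_prod_rotate (hw : ‖w‖ = 1) (hf : ContinuousOn f (Metric.sphere (0 : ℂ) 1))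
    (m : ℕ) :
    ContinuousOn (fun z => ∏ k ∈ Finset.range m, f (w ^ k * z)) (Metric.sphere (0 : ℂ) 1) :=
  continuousOn_finsetProd _ fun k _ => continuousOn_rotate (by rw [norm_pow, hw, one_pow]) hf

/-- The powers of `u f(v)` are weighted shifts whose weights form the cocycle of `f`. -/
lemma mul_cfc_pow (hu : u ∈ unitary A) (hv : v ∈ unitary A) (hw : ‖w‖ = 1)
    (hspec : spectrum ℂ v = Metric.sphere 0 1) (hrel : v * u = w • (u * v))
    (hf : ContinuousOn f (Metric.sphere (0 : ℂ) 1)) (m : ℕ) :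
    (u * cfc f v) ^ m = u ^ m * cfc (fun z => ∏ k ∈ Finset.range m, f (w ^ k * z)) v := by
  have hvn : IsStarNormal v := isStarNormal_of_mem_unitary hv
  induction m with
  | zero => simp [cfc_const_one ℂ v]
  | succ m ih =>
    have hc := continuousOn_prod_rotate hw hf m
    rw [pow_succ, ih, mul_assoc, ← mul_assoc _ u,
      cfc_mul_eq_mul_cfc_rotate hu hv hw hspec hrel hc, mul_assoc u,
      ← cfc_mul _ f v (by rw [hspec]; exact continuousOn_rotate hw hc) (by rwa [hspec]),
      ← mul_assoc, ← pow_succ]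
    congr 2
    funext z
    rw [Finset.prod_range_succ', pow_zero, one_mul]
    simp only [pow_succ, mul_assoc]

/-- The trace restricts to the Haar integral on the algebra generated by `v`. -/
lemma trace_cfc (τ : TracialState A) (hu : u ∈ unitary A) (hv : v ∈ unitary A) (hw : ‖w‖ = 1)
    (hw' : ∀ n : ℤ, n ≠ 0 → w ^ n ≠ 1)
    (hspec : spectrum ℂ v = Metric.sphere 0 1) (hrel : v * u = w • (u * v))
    (hf : ContinuousOn f (Metric.sphere (0 : ℂ) 1)) :
    τ.toLinearMap (cfc f v) = ∫ x : UnitAddCircle, f x.toCircle := by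
  have hvn : IsStarNormal v := isStarNormal_of_mem_unitary hv
  refine sphere_induction
    (P := fun f => τ.toLinearMap (cfc f v) = ∫ x : UnitAddCircle, f x.toCircle) ?_ ?_ ?_ ?_ hf
  · intro n
    rcases eq_or_ne n 0 with rfl | hn
    · have h : τ.toLinearMap 1 = 1 := τ.map_one'
      simp [cfc_const_one ℂ v, h, measureReal_def]
    · rw [integral_zpow_toCircle hn]
      refine trace_eq_zero_of_mul_eq_smul τ (Unitary.star_mem hu) (c := w ^ n) (hw' n hn) ?_
      have hc := continuousOn_zpow_sphere n
      have h1 := cfc_mul_eq_mul_cfc_rotate hu hv hw hspec hrel hc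
      simp_rw [mul_zpow] at h1
      rw [cfc_const_mul _ _ v (by rwa [hspec])] at h1
      calc star u * cfc (fun z => z ^ n) v
          = star u * (cfc (fun z => z ^ n) v * u) * star u := by
            rw [mul_assoc, mul_assoc, Unitary.mul_star_self_of_mem hu, mul_one]
        _ = _ := by
            rw [h1, ← mul_assoc, Unitary.star_mul_self_of_mem hu, one_mul, smul_mul_assoc]
  · intro f g hf hg h1 h2
    rw [cfc_add v f g (by rwa [hspec]) (by rwa [hspec]), map_add, h1, h2,
      integral_add (integrable_comp_toCircle hf) (integrable_comp_toCircle hg)]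
  · intro c f hf h
    rw [cfc_const_mul c f v (by rwa [hspec]), map_smul, h, smul_eq_mul, integral_const_mul]
  · intro f hf h
    refine eq_of_forall_dist_le fun ε hε => ?_
    obtain ⟨p, hp, hP, hfp⟩ := h (ε / 2) (half_pos hε)
    have h1 : ‖τ.toLinearMap (cfc f v) - τ.toLinearMap (cfc p v)‖ ≤ ε / 2 := by
      rw [← map_sub, ← cfc_sub f p v (by rwa [hspec]) (by rwa [hspec])]
      refine (norm_trace_le τ _).trans (norm_cfc_le (half_pos hε).le ?_)
      rwa [hspec]
    have h2 : ‖(∫ x : UnitAddCircle, f x.toCircle) - ∫ x : UnitAddCircle, p x.toCircle‖ ≤ ε / 2 := by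
      rw [← integral_sub (integrable_comp_toCircle hf) (integrable_comp_toCircle hp)]
      refine (norm_integral_le_of_norm_le_const
        (Eventually.of_forall fun x => hfp _ (toCircle_mem_sphere x))).trans ?_
      simp [measureReal_def]
    rw [hP] at h1
    have h3 := dist_triangle_right (τ.toLinearMap (cfc f v)) (∫ x : UnitAddCircle, f x.toCircle)
      (∫ x : UnitAddCircle, p x.toCircle)
    rw [dist_eq_norm _ (∫ x : UnitAddCircle, p x.toCircle),
      dist_eq_norm _ (∫ x : UnitAddCircle, p x.toCircle)] at h3
    linarith

lemma traceNorm_cfc_sq (τ : TracialState A) (hu : u ∈ unitary A) (hv : v ∈ unitary A)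
    (hw : ‖w‖ = 1) (hw' : ∀ n : ℤ, n ≠ 0 → w ^ n ≠ 1)
    (hspec : spectrum ℂ v = Metric.sphere 0 1) (hrel : v * u = w • (u * v))
    (hf : ContinuousOn f (Metric.sphere (0 : ℂ) 1)) :
    traceNorm τ (cfc f v) ^ 2 = ∫ x : UnitAddCircle, ‖f x.toCircle‖ ^ 2 := by
  have h := trace_star_mul_self τ (cfc f v)
  rw [← cfc_star, ← cfc_mul _ _ v (by rw [hspec]; exact hf.star) (by rwa [hspec]),
    trace_cfc (f := fun z => star (f z) * f z) τ hu hv hw hw' hspec hrel (hf.star.mul hf)] at h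
  have h2 : ∀ z, star (f z) * f z = ((‖f z‖ ^ 2 : ℝ) : ℂ) := fun z => by
    rw [Complex.star_def, Complex.conj_mul']
    push_cast
    rfl
  simp_rw [h2] at h
  rw [integral_complex_ofReal] at h
  exact_mod_cast h.symm

lemma traceNorm_cfc_le (τ : TracialState A) (hu : u ∈ unitary A) (hv : v ∈ unitary A)
    (hw : ‖w‖ = 1) (hw' : ∀ n : ℤ, n ≠ 0 → w ^ n ≠ 1)
    (hspec : spectrum ℂ v = Metric.sphere 0 1) (hrel : v * u = w • (u * v))
    (hf : ContinuousOn f (Metric.sphere (0 : ℂ) 1)) (hg : ContinuousOn g (Metric.sphere (0 : ℂ) 1))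
    {δ : ℝ} (hδ : 0 ≤ δ) (h : ∀ z ∈ Metric.sphere (0 : ℂ) 1, ‖f z‖ ≤ δ * ‖g z‖) :
    traceNorm τ (cfc f v) ≤ δ * traceNorm τ (cfc g v) := by
  refine (sq_le_sq₀ (traceNorm_nonneg τ _) (mul_nonneg hδ (traceNorm_nonneg τ _))).1 ?_
  rw [mul_pow, traceNorm_cfc_sq τ hu hv hw hw' hspec hrel hf,
    traceNorm_cfc_sq τ hu hv hw hw' hspec hrel hg, ← integral_const_mul]
  refine integral_mono (integrable_comp_toCircle (f := fun z => ‖f z‖ ^ 2) (hf.norm.pow 2))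
    ((integrable_comp_toCircle (f := fun z => ‖g z‖ ^ 2) (hg.norm.pow 2)).const_mul _) fun x => ?_
  rw [← mul_pow]
  exact pow_le_pow_left₀ (norm_nonneg _) (h _ (toCircle_mem_sphere x)) 2

end Calculus

/-! ### The Fuglede--Kadison determinant of `f(v)` -/

section Determinant

variable {A : Type*} [CStarAlgebra A] {u v : A} {w : ℂ} {f : ℂ → ℂ}

lemma cfc_real_cfc_complex (hv : v ∈ unitary A) {k : ℂ → ℝ} (h : ℝ → ℝ)
    (hk : ContinuousOn k (spectrum ℂ v)) (hh : Continuous h) :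
    cfc h (cfc (fun z => (k z : ℂ)) v) = cfc (fun z => (h (k z) : ℂ)) v := by
  have hvn : IsStarNormal v := isStarNormal_of_mem_unitary hv
  have hsa : IsSelfAdjoint (cfc (fun z => (k z : ℂ)) v) := by
    rw [IsSelfAdjoint, ← cfc_star]
    simp
  rw [cfc_real_eq_complex h hsa, ← cfc_comp' (fun z : ℂ => ((h z.re : ℝ) : ℂ)) (fun z => (k z : ℂ)) v
    (by fun_prop) (Complex.continuous_ofReal.comp_continuousOn hk)]
  simp

lemma absValue_cfc (hv : v ∈ unitary A) (hf : ContinuousOn f (spectrum ℂ v)) :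
    absValue (cfc f v) = cfc (fun z => (‖f z‖ : ℂ)) v := by
  have hvn : IsStarNormal v := isStarNormal_of_mem_unitary hv
  have h : star (cfc f v) * cfc f v = cfc (fun z => ((‖f z‖ ^ 2 : ℝ) : ℂ)) v := by
    rw [← cfc_star, ← cfc_mul _ _ v hf.star hf]
    refine cfc_congr fun z _ => ?_
    simp only [Complex.star_def, Complex.conj_mul']
    push_cast
    rfl
  rw [absValue, h, cfc_real_cfc_complex (k := fun z => ‖f z‖ ^ 2) hv _ (hf.norm.pow 2) Real.continuous_sqrt]
  simp [Real.sqrt_sq]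

/-- The spectral distribution of `|f(v)|` is the image of Haar measure under `|f|`. -/
lemma spectralDistribution_absValue_cfc (τ : TracialState A) (hu : u ∈ unitary A)
    (hv : v ∈ unitary A) (hw : ‖w‖ = 1) (hw' : ∀ n : ℤ, n ≠ 0 → w ^ n ≠ 1)
    (hspec : spectrum ℂ v = Metric.sphere 0 1) (hrel : v * u = w • (u * v))
    (hf : ContinuousOn f (Metric.sphere (0 : ℂ) 1)) :
    τ.spectralDistribution (absValue (cfc f v))
      = (volume : Measure UnitAddCircle).map fun x => ‖f x.toCircle‖ := by
  have hm := measurable_norm_comp_toCircle hf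
  have : (τ.spectralDistribution (absValue (cfc f v))).Regular :=
    RealRMK.regular_rieszMeasure _
  have : IsFiniteMeasure ((volume : Measure UnitAddCircle).map fun x => ‖f x.toCircle‖) :=
    Measure.isFiniteMeasure_map _ _
  refine Measure.ext_of_integral_eq_on_compactlySupported fun g => ?_
  rw [TracialState.spectralDistribution, RealRMK.integral_rieszMeasure,
    integral_map (f := fun t => g t) hm.aemeasurable g.continuous.aestronglyMeasurable]
  change (τ.toLinearMap (cfc (fun t : ℝ => g t) (absValue (cfc f v)))).re = _
  have hc : ContinuousOn (fun z => (g ‖f z‖ : ℂ)) (Metric.sphere (0 : ℂ) 1) :=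
    Complex.continuous_ofReal.comp_continuousOn (g.continuous.comp_continuousOn hf.norm)
  rw [absValue_cfc hv (by rwa [hspec]),
    cfc_real_cfc_complex (k := fun z => ‖f z‖) hv (fun t => g t) (by rw [hspec]; exact hf.norm)
      g.continuous,
    trace_cfc (f := fun z => (g ‖f z‖ : ℂ)) τ hu hv hw hw' hspec hrel hc, integral_complex_ofReal, Complex.ofReal_re]

lemma fugledeKadisonDet_cfc (τ : TracialState A) (hu : u ∈ unitary A)
    (hv : v ∈ unitary A) (hw : ‖w‖ = 1) (hw' : ∀ n : ℤ, n ≠ 0 → w ^ n ≠ 1)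
    (hspec : spectrum ℂ v = Metric.sphere 0 1) (hrel : v * u = w • (u * v))
    (hf : ContinuousOn f (Metric.sphere (0 : ℂ) 1)) :
    fugledeKadisonDet τ (cfc f v) = expIntegralLog f := by
  have hm := measurable_norm_comp_toCircle hf
  have hlog : Measurable fun t : ℝ => ENNReal.log (ENNReal.ofReal t) :=
    ENNReal.measurable_ofReal.ennreal_log
  rw [expIntegralLog_eq, fugledeKadisonDet,
    spectralDistribution_absValue_cfc τ hu hv hw hw' hspec hrel hf, extIntegral, extIntegral,
    lintegral_map hlog.ereal_toENNReal hm, lintegral_map (f := fun t : ℝ => (-ENNReal.log (ENNReal.ofReal t)).toENNReal)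
      hlog.neg.ereal_toENNReal hm]
  simp_rw [ofReal_norm]

end Determinant

/-! ### The spectrum of `u f(v)` -/

section Spectrum

variable {A : Type*} [CStarAlgebra A] {u v : A} {w : ℂ} {f : ℂ → ℂ}

lemma commute_cfc_self (hv : v ∈ unitary A) (f : ℂ → ℂ) : Commute v (cfc f v) := by
  have hvn : IsStarNormal v := isStarNormal_of_mem_unitary hv
  conv_lhs => rw [← cfc_id ℂ v]
  exact cfc_commute_cfc _ _ v

lemma mul_mul_cfc_eq_smul (hv : v ∈ unitary A) (hrel : v * u = w • (u * v)) (f : ℂ → ℂ) :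
    v * (u * cfc f v) = w • (u * cfc f v * v) := by
  rw [← mul_assoc, hrel, smul_mul_assoc, mul_assoc, (commute_cfc_self hv f).eq, mul_assoc]

/-- With `R = (c - T)⁻¹` and `φ` a functional that kills `1, T, …, T ^ (m - 1)`, the geometric sum
for `c ^ m - T ^ m` gives `φ (c ^ m R) = φ (T ^ m R)`. -/
lemma pow_mul_apply_resolvent {T R : A} {c : ℂ} (hR : c • R = 1 + T * R) (φ : A →ₗ[ℂ] ℂ) (m : ℕ)
    (hφ : ∀ k < m, φ (T ^ k) = 0) : c ^ m * φ R = φ (T ^ m * R) := by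
  induction m with
  | zero => simp
  | succ m ih =>
    calc c ^ (m + 1) * φ R = c * (c ^ m * φ R) := by ring
      _ = φ (T ^ m * (c • R)) := by
        rw [ih fun k hk => hφ k (by omega), mul_smul_comm, map_smul, smul_eq_mul]
      _ = φ (T ^ (m + 1) * R) := by
        rw [hR, mul_add, mul_one, map_add, hφ m (by omega), zero_add, ← mul_assoc, ← pow_succ]

lemma continuousOn_rotate_inv (hw : ‖w‖ = 1) (hf : ContinuousOn f (Metric.sphere (0 : ℂ) 1)) :
    ContinuousOn (fun z => f (w⁻¹ * z)) (Metric.sphere (0 : ℂ) 1) :=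
  continuousOn_rotate (by rw [norm_inv, hw, inv_one]) hf

/-- If the weight `f` has modulus at most `δ` on the translate by `w⁻¹` of the support of `φ`, where
`δ` is small against the resolvent `R` of `u f(v)` at `c`, then `φ(v) R` has a large diagonal part,
and comparing it with the `m`-th off-diagonal part of `R` bounds the cocycle on the support
of `φ`. -/
lemma traceNorm_le_of_resolvent (τ : TracialState A) (hu : u ∈ unitary A) (hv : v ∈ unitary A)
    (hw : ‖w‖ = 1) (hw' : ∀ n : ℤ, n ≠ 0 → w ^ n ≠ 1)
    (hspec : spectrum ℂ v = Metric.sphere 0 1) (hrel : v * u = w • (u * v))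
    (hf : ContinuousOn f (Metric.sphere (0 : ℂ) 1)) {R : A} {c : ℂ}
    (hR : c • R = 1 + u * cfc f v * R) {φ : ℂ → ℂ}
    (hφ : ContinuousOn φ (Metric.sphere (0 : ℂ) 1)) {δ : ℝ} (hδ : 0 ≤ δ) (hδR : ‖R‖ * δ ≤ 1 / 2)
    (hsupp : ∀ z ∈ Metric.sphere (0 : ℂ) 1, φ z ≠ 0 → ‖f (w⁻¹ * z)‖ ≤ δ) (m : ℕ) :
    traceNorm τ (cfc (fun z => φ z * ∏ k ∈ Finset.range m, f (w ^ k * z)) v)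
      ≤ 2 * ‖R‖ * ‖c‖ * ‖c‖ ^ m * traceNorm τ (cfc φ v) := by
  have hvn : IsStarNormal v := isStarNormal_of_mem_unitary hv
  have hw0 : w ≠ 0 := norm_ne_zero_iff.1 (by rw [hw]; exact one_ne_zero)
  have hF := continuousOn_prod_rotate hw hf m
  have hg := continuousOn_rotate_inv hw hf
  set F : ℂ → ℂ := fun z => ∏ k ∈ Finset.range m, f (w ^ k * z) with hFdef
  set g : ℂ → ℂ := fun z => f (w⁻¹ * z) with hgdef
  have hφF : ContinuousOn (fun z => φ z * F z) (Metric.sphere (0 : ℂ) 1) := hφ.mul hF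
  set T := u * cfc f v with hT
  set a := cfc φ v with ha
  set b := cfc (fun z => φ z * F z) v with hb
  have hbaF : a * cfc F v = b := (cfc_mul φ F v (by rwa [hspec]) (by rwa [hspec])).symm
  have hab : Commute a (star b) := by
    rw [hb, ← cfc_star]
    exact cfc_commute_cfc _ _ v
  have hTm : star u ^ m * T ^ m = cfc F v := by
    rw [hT, mul_cfc_pow hu hv hw hspec hrel hf m, ← mul_assoc, ← star_pow,
      Unitary.star_mul_self_of_mem (pow_mem hu m), one_mul]
  have hvT : v * T = w • (T * v) := mul_mul_cfc_eq_smul hv hrel f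
  have hva : Commute v (star b * a) := by
    rw [hb, ha, ← cfc_star]
    exact (commute_cfc_self hv _).mul_right (commute_cfc_self hv _)
  -- The lower-order terms `b* a u⁻ᵐ Tᵏ` have trace zero, by their transformation under `v`.
  have hoff : c ^ m * τ.toLinearMap (star b * a * star u ^ m * R)
      = τ.toLinearMap (star b * b * R) := by
    have h := pow_mul_apply_resolvent hR
      (τ.toLinearMap ∘ₗ LinearMap.mulLeft ℂ (star b * a * star u ^ m)) m fun k hk => by
        refine trace_eq_zero_of_mul_eq_smul τ hv (c := w⁻¹ ^ m * w ^ k) ?_ ?_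
        · have h := hw' ((k : ℤ) - m) (by omega)
          rw [zpow_sub₀ hw0, zpow_natCast, zpow_natCast, div_eq_mul_inv, mul_comm,
            ← inv_pow] at h
          exact h
        · simp only [LinearMap.mulLeft_apply]
          rw [← mul_assoc, ← mul_assoc, hva.eq, mul_assoc (star b * a) v,
            mul_pow_eq_smul (mul_star_eq_smul hu hw hrel) m, mul_smul_comm, smul_mul_assoc,
            ← mul_assoc (star b * a), mul_assoc _ v, mul_pow_eq_smul hvT k, mul_smul_comm,
            smul_smul, ← mul_assoc]
    simp only [LinearMap.comp_apply, LinearMap.mulLeft_apply] at h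
    rw [h, ← mul_assoc, mul_assoc _ _ (T ^ m), hTm, mul_assoc (star b), hbaF]
  have hoff_le : ‖τ.toLinearMap (star b * a * star u ^ m * R)‖
      ≤ traceNorm τ b * (‖R‖ * traceNorm τ a) := by
    have h1 : τ.toLinearMap (star b * a * star u ^ m * R)
        = τ.toLinearMap (star b * (star u ^ m * R * a)) := by
      have h2 := τ.tracial' a (star b * star u ^ m * R)
      simp only [LinearMap.coe_toAddHom, AddHom.toFun_eq_coe] at h2
      rw [← hab.eq]
      simp only [mul_assoc] at h2 ⊢
      exact h2
    rw [h1]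
    refine (norm_trace_star_mul_le τ _ _).trans ?_
    refine mul_le_mul_of_nonneg_left ((traceNorm_mul_le τ _ _).trans_eq ?_) (traceNorm_nonneg τ _)
    rw [CStarRing.norm_mem_unitary_mul _ (pow_mem (Unitary.star_mem hu) m)]
  have hgu : u * cfc f v = cfc g v * u := by
    rw [cfc_mul_eq_mul_cfc_rotate hu hv hw hspec hrel hg]
    simp only [hgdef, inv_mul_cancel_left₀ hw0]
  have hdiag : c * τ.toLinearMap (star b * b * R)
      = ((traceNorm τ b ^ 2 : ℝ) : ℂ) + τ.toLinearMap (star b * b * (T * R)) := by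
    rw [← trace_star_mul_self, ← smul_eq_mul, ← map_smul, ← mul_smul_comm, hR, mul_add, mul_one,
      map_add]
  have herr : ‖τ.toLinearMap (star b * b * (T * R))‖
      ≤ traceNorm τ b * (‖R‖ * (δ * traceNorm τ b)) := by
    have hbg : b * cfc g v = cfc (fun z => φ z * F z * g z) v :=
      (cfc_mul _ g v (by rwa [hspec]) (by rwa [hspec])).symm
    have hcomm : Commute (b * cfc g v) (star b) := by
      rw [hbg, hb, ← cfc_star]
      exact cfc_commute_cfc _ _ v
    have h1 : τ.toLinearMap (star b * b * (T * R))
        = τ.toLinearMap (star b * (u * R * (b * cfc g v))) := by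
      have h2 := τ.tracial' (b * cfc g v) (star b * (u * R))
      simp only [LinearMap.coe_toAddHom, AddHom.toFun_eq_coe] at h2
      rw [hT, hgu, mul_assoc (cfc g v), mul_assoc (star b) b, ← mul_assoc b, ← mul_assoc (star b),
        ← hcomm.eq, mul_assoc (b * cfc g v), h2, mul_assoc (star b)]
    rw [h1]
    refine (norm_trace_star_mul_le τ _ _).trans ?_
    refine mul_le_mul_of_nonneg_left ((traceNorm_mul_le τ _ _).trans ?_) (traceNorm_nonneg τ _)
    rw [CStarRing.norm_mem_unitary_mul _ hu, hbg]
    refine mul_le_mul_of_nonneg_left ?_ (norm_nonneg _)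
    refine traceNorm_cfc_le (f := fun z => φ z * F z * g z) τ hu hv hw hw' hspec hrel
      (hφF.mul hg) hφF hδ fun z hz => ?_
    rw [norm_mul (φ z * F z), mul_comm]
    rcases eq_or_ne (φ z) 0 with h0 | h0
    · simp [h0]
    · exact mul_le_mul_of_nonneg_right (hsupp z hz h0) (norm_nonneg _)
  have hnb := traceNorm_nonneg τ b
  have hsq : traceNorm τ b ^ 2
      ≤ ‖c‖ * (‖c‖ ^ m * (traceNorm τ b * (‖R‖ * traceNorm τ a)))
        + traceNorm τ b * (‖R‖ * (δ * traceNorm τ b)) := by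
    have h1 : ((traceNorm τ b ^ 2 : ℝ) : ℂ)
        = c * τ.toLinearMap (star b * b * R) - τ.toLinearMap (star b * b * (T * R)) := by
      rw [hdiag]; ring
    have h2 : ‖((traceNorm τ b ^ 2 : ℝ) : ℂ)‖ = traceNorm τ b ^ 2 := by
      rw [Complex.norm_real, Real.norm_of_nonneg (by positivity)]
    rw [← h2, h1, ← hoff]
    refine (norm_sub_le _ _).trans (add_le_add ?_ herr)
    rw [norm_mul, norm_mul, norm_pow]
    gcongr
  rcases hnb.eq_or_lt with h0 | h0
  · rw [← h0]
    have := traceNorm_nonneg τ a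
    positivity
  · have h3 : traceNorm τ b * (‖R‖ * (δ * traceNorm τ b)) ≤ 1 / 2 * traceNorm τ b ^ 2 := by
      calc _ = ‖R‖ * δ * traceNorm τ b ^ 2 := by ring
        _ ≤ _ := by gcongr
    have h4 : traceNorm τ b * traceNorm τ b
        ≤ traceNorm τ b * (2 * ‖R‖ * ‖c‖ * ‖c‖ ^ m * traceNorm τ a) := by nlinarith
    exact le_of_mul_le_mul_left h4 h0

/-- If `c` is in the resolvent set of `u f(v)`, then near the first iterate of a zero of `f` the
cocycle grows at most like the powers of `‖c‖`. -/
lemma exists_norm_prod_le_near_zero (τ : TracialState A) (hu : u ∈ unitary A) (hv : v ∈ unitary A)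
    (hw : ‖w‖ = 1) (hw' : ∀ n : ℤ, n ≠ 0 → w ^ n ≠ 1)
    (hspec : spectrum ℂ v = Metric.sphere 0 1) (hrel : v * u = w • (u * v))
    (hf : ContinuousOn f (Metric.sphere (0 : ℂ) 1)) {z₀ : ℂ}
    (hz₀ : z₀ ∈ Metric.sphere (0 : ℂ) 1) (hfz₀ : f z₀ = 0) {c : ℂ}
    (hc : c ∉ spectrum ℂ (u * cfc f v)) :
    ∃ C ≥ 0, ∃ η > 0, ∀ m : ℕ, ∀ z ∈ Metric.sphere (0 : ℂ) 1, ‖z - w * z₀‖ < η →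
      ‖∏ k ∈ Finset.range m, f (w ^ k * z)‖ ≤ C * ‖c‖ ^ m := by
  have hw0 : w ≠ 0 := norm_ne_zero_iff.1 (by rw [hw]; exact one_ne_zero)
  obtain ⟨R, hR⟩ := (spectrum.notMem_iff.1 hc).exists_right_inv
  have hR' : c • R = 1 + u * cfc f v * R := by
    rw [sub_mul, sub_eq_iff_eq_add, Algebra.algebraMap_eq_smul_one, smul_mul_assoc, one_mul] at hR
    exact hR
  set δ : ℝ := 1 / (2 * (‖R‖ + 1)) with hδ
  have hδ0 : 0 < δ := by positivity
  have hδR : ‖R‖ * δ ≤ 1 / 2 := by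
    rw [hδ, mul_one_div, div_le_div_iff₀ (by positivity) (by norm_num)]
    linarith
  have hg := continuousOn_rotate_inv hw hf
  have hwz₀ : w * z₀ ∈ Metric.sphere (0 : ℂ) 1 := by simpa [hw] using hz₀
  obtain ⟨η, hη, hball⟩ := Metric.continuousOn_iff.1 hg _ hwz₀ δ hδ0
  have hclose : ∀ z ∈ Metric.sphere (0 : ℂ) 1, ‖z - w * z₀‖ < η → ‖f (w⁻¹ * z)‖ ≤ δ := by
    intro z hz hzη
    have := hball z hz (by rwa [dist_eq_norm])
    rw [inv_mul_cancel_left₀ hw0, hfz₀, dist_zero_right] at this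
    exact this.le
  refine ⟨2 * ‖R‖ * ‖c‖, by positivity, η, hη, fun m z₁ hz₁ hz₁η => ?_⟩
  by_contra! hlt
  set K : ℝ := 2 * ‖R‖ * ‖c‖ * ‖c‖ ^ m with hK
  have hK0 : 0 ≤ K := by positivity
  have hF := continuousOn_prod_rotate hw hf m
  set F : ℂ → ℂ := fun z => ∏ k ∈ Finset.range m, f (w ^ k * z) with hFdef
  -- A bump supported where `z` is close to `w z₀` and the cocycle exceeds the bound.
  let ρ : ℂ → ℝ := fun z => max 0 (η - ‖z - w * z₀‖) * max 0 (‖F z‖ - K)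
  have hρ : ContinuousOn ρ (Metric.sphere (0 : ℂ) 1) :=
    (Continuous.continuousOn (by fun_prop)).mul
      (continuousOn_const.sup (hF.norm.sub continuousOn_const))
  have hφ : ContinuousOn (fun z => (ρ z : ℂ)) (Metric.sphere (0 : ℂ) 1) :=
    Complex.continuous_ofReal.comp_continuousOn hρ
  have hsupp : ∀ z ∈ Metric.sphere (0 : ℂ) 1, (ρ z : ℂ) ≠ 0 → ‖f (w⁻¹ * z)‖ ≤ δ := by
    intro z hz h
    refine hclose z hz ?_
    by_contra! hge
    apply h
    simp only [ρ]
    rw [max_eq_left (by linarith), zero_mul, Complex.ofReal_zero]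
  have h1 := traceNorm_le_of_resolvent τ hu hv hw hw' hspec hrel hf hR' hφ hδ0.le hδR hsupp m
  have h2 := pow_le_pow_left₀ (traceNorm_nonneg τ _) h1 2
  have hφF : ContinuousOn (fun z => (ρ z : ℂ) * F z) (Metric.sphere (0 : ℂ) 1) := hφ.mul hF
  rw [mul_pow, traceNorm_cfc_sq τ hu hv hw hw' hspec hrel hφF,
    traceNorm_cfc_sq τ hu hv hw hw' hspec hrel hφ, ← hK, ← integral_const_mul] at h2
  have hd : ContinuousOn (fun z => ‖(ρ z : ℂ) * F z‖ ^ 2 - K ^ 2 * ‖(ρ z : ℂ)‖ ^ 2)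
      (Metric.sphere (0 : ℂ) 1) :=
    (hφF.norm.pow 2).sub (continuousOn_const.mul (hφ.norm.pow 2))
  have hd' : ∀ z, ‖(ρ z : ℂ) * F z‖ ^ 2 - K ^ 2 * ‖(ρ z : ℂ)‖ ^ 2
      = ρ z ^ 2 * (‖F z‖ ^ 2 - K ^ 2) := by
    intro z
    rw [norm_mul, Complex.norm_real, mul_pow, Real.norm_eq_abs, sq_abs]
    ring
  have hpos : 0 < ∫ x : UnitAddCircle,
      (‖(ρ x.toCircle : ℂ) * F x.toCircle‖ ^ 2 - K ^ 2 * ‖(ρ x.toCircle : ℂ)‖ ^ 2) := by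
    obtain ⟨x₁, hx₁⟩ := exists_toCircle_eq hz₁
    refine Continuous.integral_pos_of_hasCompactSupport_nonneg_nonzero (x := x₁)
      (continuous_comp_toCircle hd) (HasCompactSupport.of_compactSpace _) (fun x => ?_) ?_
    · change 0 ≤ ‖(ρ x.toCircle : ℂ) * F x.toCircle‖ ^ 2 - K ^ 2 * ‖(ρ x.toCircle : ℂ)‖ ^ 2
      rw [hd']
      rcases le_total ‖F x.toCircle‖ K with h | h
      · have : ρ x.toCircle = 0 := by
          simp only [ρ]
          rw [max_eq_left (b := ‖F x.toCircle‖ - K) (by linarith), mul_zero]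
        rw [this]
        simp
      · exact mul_nonneg (sq_nonneg _) (sub_nonneg.2 (pow_le_pow_left₀ hK0 h 2))
    · rw [hx₁, hd']
      have h3 : 0 < ρ z₁ := mul_pos (lt_max_of_lt_right (by linarith))
        (lt_max_of_lt_right (by linarith))
      have h4 : K ^ 2 < ‖F z₁‖ ^ 2 := pow_lt_pow_left₀ hlt hK0 two_ne_zero
      exact (mul_pos (pow_pos h3 2) (by linarith)).ne'
  rw [integral_sub (integrable_comp_toCircle (f := fun z => ‖(ρ z : ℂ) * F z‖ ^ 2) (hφF.norm.pow 2))
    (integrable_comp_toCircle (f := fun z => K ^ 2 * ‖(ρ z : ℂ)‖ ^ 2)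
      (continuousOn_const.mul (hφ.norm.pow 2)))] at hpos
  linarith

/-- If `f` has a zero, the resolvent set of `u f(v)` does not meet the punctured open disc whose
radius is the logarithmic mean of `f`. -/
lemma expIntegralLog_le_norm_of_notMem_spectrum (τ : TracialState A) (hu : u ∈ unitary A)
    (hv : v ∈ unitary A) (hw : ‖w‖ = 1) (hw' : ∀ n : ℤ, n ≠ 0 → w ^ n ≠ 1)
    (hspec : spectrum ℂ v = Metric.sphere 0 1) (hrel : v * u = w • (u * v))
    (hf : ContinuousOn f (Metric.sphere (0 : ℂ) 1)) {z₀ : ℂ}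
    (hz₀ : z₀ ∈ Metric.sphere (0 : ℂ) 1) (hfz₀ : f z₀ = 0) {c : ℂ} (hc0 : c ≠ 0)
    (hc : c ∉ spectrum ℂ (u * cfc f v)) : expIntegralLog f ≤ ‖c‖ := by
  obtain ⟨C, hC, η, hη, hnear⟩ :=
    exists_norm_prod_le_near_zero τ hu hv hw hw' hspec hrel hf hz₀ hfz₀ hc
  obtain ⟨N, hN⟩ := exists_forall_exists_norm_rotate_sub_lt hw hw' (z₀ := w * z₀)
    (by simpa [hw] using hz₀) hη
  obtain ⟨M, hM1, hM⟩ := exists_norm_le_of_continuousOn_sphere hf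
  have hprod : ∀ j : ℕ, ∀ z ∈ Metric.sphere (0 : ℂ) 1,
      ‖∏ k ∈ Finset.range j, f (w ^ k * z)‖ ≤ M ^ j := by
    intro j z hz
    rw [norm_prod]
    refine (Finset.prod_le_prod (fun _ _ => norm_nonneg _)
      fun k _ => hM _ (mem_sphere_rotate hw k hz)).trans_eq ?_
    simp
  -- Split an orbit segment of length `m + N` at the first time `j` when it is close to `w z₀`.
  have hglobal : ∀ m : ℕ, ∀ z ∈ Metric.sphere (0 : ℂ) 1,
      ‖∏ k ∈ Finset.range (m + N), f (w ^ k * z)‖ ≤ M ^ N * (C * ‖c‖ ^ m) := by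
    intro m z hz
    obtain ⟨j, hjN, hj⟩ := hN z hz
    have hsplit : ∏ k ∈ Finset.range (m + N), f (w ^ k * z)
        = (∏ k ∈ Finset.range j, f (w ^ k * z)) * (∏ k ∈ Finset.range m, f (w ^ k * (w ^ j * z)))
          * ∏ k ∈ Finset.range (N - j), f (w ^ k * (w ^ (j + m) * z)) := by
      have : m + N = j + m + (N - j) := by omega
      rw [this, Finset.prod_range_add, Finset.prod_range_add]
      simp only [pow_add, mul_assoc, mul_left_comm]
    rw [hsplit, norm_mul, norm_mul]
    calc _ ≤ M ^ j * (C * ‖c‖ ^ m) * M ^ (N - j) := by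
          gcongr
          · exact hprod j z hz
          · exact hnear m _ (mem_sphere_rotate hw j hz) hj
          · exact hprod _ _ (mem_sphere_rotate hw _ hz)
      _ = M ^ (j + (N - j)) * (C * ‖c‖ ^ m) := by rw [pow_add]; ring
      _ = _ := by rw [Nat.add_sub_cancel' hjN.le]
  have hcn : 0 < ‖c‖ := norm_pos_iff.2 hc0
  by_contra! hlt
  have hD : 0 < expIntegralLog f := hcn.trans hlt
  have hbdd : ∀ m : ℕ, (expIntegralLog f / ‖c‖) ^ m ≤ M ^ N * C / expIntegralLog f ^ N := by
    intro m
    have := pow_le_of_norm_prod_le hw hf (hglobal m)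
    rw [div_pow, div_le_div_iff₀ (by positivity) (by positivity), ← pow_add]
    linarith
  obtain ⟨m, hm⟩ := pow_unbounded_of_one_lt (M ^ N * C / expIntegralLog f ^ N)
    ((one_lt_div hcn).2 hlt)
  exact absurd (hbdd m) (not_le.2 hm)

/-- The spectral radius bound, from `‖T ^ m‖ = sup |f_m|`. -/
lemma norm_le_expIntegralLog_of_mem_spectrum [Nontrivial A] (hu : u ∈ unitary A)
    (hv : v ∈ unitary A) (hw : ‖w‖ = 1) (hw' : ∀ n : ℤ, n ≠ 0 → w ^ n ≠ 1)
    (hspec : spectrum ℂ v = Metric.sphere 0 1) (hrel : v * u = w • (u * v))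
    (hf : ContinuousOn f (Metric.sphere (0 : ℂ) 1)) {c : ℂ}
    (hc : c ∈ spectrum ℂ (u * cfc f v)) : ‖c‖ ≤ expIntegralLog f := by
  have hvn : IsStarNormal v := isStarNormal_of_mem_unitary hv
  by_contra! hlt
  obtain ⟨m, hm⟩ := exists_norm_prod_lt_pow hw hw' hf hlt
  have h0 : 0 < ‖c‖ := (expIntegralLog_nonneg f).trans_lt hlt
  have h1 := spectrum.norm_le_norm_of_mem (spectrum.pow_mem_pow _ m hc)
  rw [mul_cfc_pow hu hv hw hspec hrel hf, CStarRing.norm_mem_unitary_mul _ (pow_mem hu m),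
    norm_pow] at h1
  refine absurd h1 (not_le.2 ?_)
  rw [norm_cfc_lt_iff _ v (pow_pos h0 m) (by rw [hspec]; exact continuousOn_prod_rotate hw hf m),
    hspec]
  exact hm

/-- For invertible `T = u f(v)`, the spectral radius bound for the inverse, from
`‖T ^ (-m)‖ = sup |f_m|⁻¹`. -/
lemma expIntegralLog_le_norm_of_mem_spectrum [Nontrivial A] (hu : u ∈ unitary A)
    (hv : v ∈ unitary A) (hw : ‖w‖ = 1) (hw' : ∀ n : ℤ, n ≠ 0 → w ^ n ≠ 1)
    (hspec : spectrum ℂ v = Metric.sphere 0 1) (hrel : v * u = w • (u * v))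
    (hf : ContinuousOn f (Metric.sphere (0 : ℂ) 1)) (h0 : ∀ z ∈ Metric.sphere (0 : ℂ) 1, f z ≠ 0)
    {c : ℂ} (hc0 : c ≠ 0) (hc : c ∈ spectrum ℂ (u * cfc f v)) : expIntegralLog f ≤ ‖c‖ := by
  have hvn : IsStarNormal v := isStarNormal_of_mem_unitary hv
  by_contra! hlt
  have hcn : 0 < ‖c‖ := norm_pos_iff.2 hc0
  obtain ⟨m, hm⟩ := exists_pow_lt_norm_prod hw hw' hf h0 hcn hlt
  have hF := continuousOn_prod_rotate hw hf m
  have hTm := mul_cfc_pow hu hv hw hspec hrel hf m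
  set F : ℂ → ℂ := fun z => ∏ k ∈ Finset.range m, f (w ^ k * z) with hFdef
  have hF0 : ∀ z ∈ Metric.sphere (0 : ℂ) 1, F z ≠ 0 := fun z hz =>
    norm_pos_iff.1 ((pow_pos hcn m).trans (hm z hz))
  have hFinv : ContinuousOn (fun z => (F z)⁻¹) (Metric.sphere (0 : ℂ) 1) := hF.inv₀ hF0
  have hright : cfc F v * cfc (fun z => (F z)⁻¹) v = 1 := by
    rw [← cfc_mul F _ v (by rwa [hspec]) (by rwa [hspec]), ← cfc_one ℂ v]
    refine cfc_congr fun z hz => ?_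
    rw [hspec] at hz
    simpa using mul_inv_cancel₀ (hF0 z hz)
  have hleft : cfc (fun z => (F z)⁻¹) v * cfc F v = 1 := by
    rw [(cfc_commute_cfc _ _ v).eq, hright]
  have hum := pow_mem hu m
  let U : Aˣ := ⟨u ^ m * cfc F v, cfc (fun z => (F z)⁻¹) v * star (u ^ m),
    by rw [mul_assoc, ← mul_assoc (cfc F v), hright, one_mul, Unitary.mul_star_self_of_mem hum],
    by rw [mul_assoc, ← mul_assoc (star (u ^ m)), Unitary.star_mul_self_of_mem hum, one_mul, hleft]⟩
  have h1 := spectrum.pow_mem_pow _ m hc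
  rw [hTm] at h1
  have h2 := spectrum.inv_mem_iff (r := Units.mk0 (c ^ m) (pow_ne_zero m hc0)) (a := U) |>.1 h1
  have h3 := spectrum.norm_le_norm_of_mem h2
  rw [Units.val_inv_eq_inv_val, Units.val_mk0, norm_inv, norm_pow] at h3
  change _ ≤ ‖cfc (fun z => (F z)⁻¹) v * star (u ^ m)‖ at h3
  rw [CStarRing.norm_mul_mem_unitary _ (Unitary.star_mem hum)] at h3
  refine absurd h3 (not_le.2 ?_)
  rw [norm_cfc_lt_iff _ v (inv_pos.2 (pow_pos hcn m)) (by rwa [hspec]), hspec]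
  intro z hz
  rw [norm_inv]
  exact inv_strictAnti₀ (pow_pos hcn m) (hm z hz)

/-- The determinant and the spectrum of `u f(v)` in any C*-algebra with a tracial state that
contains unitaries `u`, `v` with `v u = w u v`, where `w` is not a root of unity. -/
theorem det_and_spectrum (τ : TracialState A) (hu : u ∈ unitary A) (hv : v ∈ unitary A)
    (hw : ‖w‖ = 1) (hw' : ∀ n : ℤ, n ≠ 0 → w ^ n ≠ 1) (hrel : v * u = w • (u * v))
    (hf : ContinuousOn f (Metric.sphere (0 : ℂ) 1)) :
    fugledeKadisonDet τ (cfc f v) = expIntegralLog f ∧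
    (IsUnit (cfc f v) →
      spectrum ℂ (u * cfc f v) = Metric.sphere (0 : ℂ) (fugledeKadisonDet τ (cfc f v))) ∧
    (¬ IsUnit (cfc f v) →
      spectrum ℂ (u * cfc f v) = Metric.closedBall (0 : ℂ) (fugledeKadisonDet τ (cfc f v))) := by
  have hvn : IsStarNormal v := isStarNormal_of_mem_unitary hv
  have : Nontrivial A := nontrivial_of_tracialState τ
  have hspec := spectrum_eq_sphere hu hv hw hw' hrel
  have hdet := fugledeKadisonDet_cfc τ hu hv hw hw' hspec hrel hf
  have hunit : IsUnit (cfc f v) ↔ ∀ z ∈ Metric.sphere (0 : ℂ) 1, f z ≠ 0 := by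
    rw [isUnit_cfc_iff f v (by rwa [hspec]), hspec]
  have hmulunit : IsUnit (u * cfc f v) ↔ IsUnit (cfc f v) :=
    Units.isUnit_units_mul
      ⟨u, star u, Unitary.mul_star_self_of_mem hu, Unitary.star_mul_self_of_mem hu⟩ _
  -- Conjugation by `v` multiplies `u f(v)` by `w`.
  have hinv : ∀ c ∈ spectrum ℂ (u * cfc f v), w * c ∈ spectrum ℂ (u * cfc f v) := fun c hc =>
    smul_mem_spectrum_of_mul_eq_smul hv hw (mul_mul_cfc_eq_smul hv hrel f) hc
  have hmem := @mem_of_norm_eq w _ (spectrum.isClosed (u * cfc f v)) hw hw' hinv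
  have hupper : ∀ c ∈ spectrum ℂ (u * cfc f v), ‖c‖ ≤ expIntegralLog f := fun c hc =>
    norm_le_expIntegralLog_of_mem_spectrum hu hv hw hw' hspec hrel hf hc
  refine ⟨hdet, fun h => ?_, fun h => ?_⟩
  · have hnorm : ∀ c ∈ spectrum ℂ (u * cfc f v), ‖c‖ = expIntegralLog f := by
      intro c hc
      refine (hupper c hc).antisymm ?_
      refine expIntegralLog_le_norm_of_mem_spectrum hu hv hw hw' hspec hrel hf (hunit.1 h) ?_ hc
      rintro rfl
      exact (spectrum.zero_mem_iff ℂ).1 hc (hmulunit.2 h)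
    obtain ⟨c, hc⟩ := spectrum.nonempty (u * cfc f v)
    rw [hdet]
    ext d
    rw [mem_sphere_zero_iff_norm]
    exact ⟨hnorm d, fun hd => hmem hc (by rw [hd, hnorm c hc])⟩
  · obtain ⟨z₀, hz₀, hfz₀⟩ : ∃ z ∈ Metric.sphere (0 : ℂ) 1, f z = 0 := by
      simpa using mt hunit.2 h
    have hzero : (0 : ℂ) ∈ spectrum ℂ (u * cfc f v) := by
      rw [spectrum.zero_mem_iff]
      exact mt hmulunit.1 h
    rw [hdet]
    refine Set.Subset.antisymm (fun c hc => mem_closedBall_zero_iff.2 (hupper c hc)) ?_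
    rcases (expIntegralLog_nonneg f).eq_or_lt with h0 | h0
    · rw [← h0, Metric.closedBall_zero]
      simpa using hzero
    · rw [← closure_ball _ h0.ne']
      refine closure_minimal (fun c hc => ?_) (spectrum.isClosed _)
      rcases eq_or_ne c 0 with rfl | hc0
      · exact hzero
      · by_contra hcs
        have := expIntegralLog_le_norm_of_notMem_spectrum τ hu hv hw hw' hspec hrel hf hz₀ hfz₀
          hc0 hcs
        exact absurd (mem_ball_zero_iff.1 hc) (not_lt.2 this)

lemma exp_zpow_ne_one {θ : ℝ} (hirr : Irrational θ) (n : ℤ) (hn : n ≠ 0) :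
    Complex.exp (2 * Real.pi * Complex.I * θ) ^ n ≠ 1 := by
  rw [← Complex.exp_int_mul, Ne, Complex.exp_eq_one_iff]
  rintro ⟨k, hk⟩
  have h1 : (n : ℂ) * θ = k := by
    refine mul_right_cancel₀ Complex.two_pi_I_ne_zero ?_
    linear_combination hk
  have h2 : (n : ℝ) * θ = k := by exact_mod_cast h1
  exact (hirr.intCast_mul hn).ne_int k h2

end Spectrum

end RotationAlgebra

theorem mainTheorem1 {H : Type*} [NormedAddCommGroup H] [InnerProductSpace ℂ H] [CompleteSpace H]
    (R : VonNeumannAlgebra H) (hR : IsHyperfiniteIIOneFactor R)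
    (τ : TracialState R.toStarSubalgebra) (hτf : τ.IsFaithful) (hτn : τ.IsNormal)
    (θ : ℝ) (hθ : θ ∈ Set.Ioo (0 : ℝ) 1) (hirr : Irrational θ)
    (u v : R.toStarSubalgebra)
    (hu : u ∈ unitary R.toStarSubalgebra) (hv : v ∈ unitary R.toStarSubalgebra)
    (hgen : Set.centralizer (Set.centralizer ({(u : H →L[ℂ] H), (v : H →L[ℂ] H)} :
      Set (H →L[ℂ] H))) = (R : Set (H →L[ℂ] H)))
    (hrel : v * u = Complex.exp (2 * Real.pi * Complex.I * θ) • (u * v))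
    (f : ℂ → ℂ) (hf : ContinuousOn f (Metric.sphere (0 : ℂ) 1)) :
    fugledeKadisonDet τ (cfc f v) = expIntegralLog f ∧
    (IsUnit (cfc f v) →
      spectrum ℂ (u * cfc f v) = Metric.sphere (0 : ℂ) (fugledeKadisonDet τ (cfc f v))) ∧
    (¬ IsUnit (cfc f v) →
      spectrum ℂ (u * cfc f v) = Metric.closedBall (0 : ℂ) (fugledeKadisonDet τ (cfc f v))) :=
  RotationAlgebra.det_and_spectrum τ hu hv
    (by
      have h : 2 * Real.pi * Complex.I * θ = ((2 * Real.pi * θ : ℝ) : ℂ) * Complex.I := by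
        push_cast
        ring
      rw [h, Complex.norm_exp_ofReal_mul_I])
    (RotationAlgebra.exp_zpow_ne_one hirr) hrel hf
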